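/- **Setting.** Let $D=\mathbb{C}$ or $D=\{|z|<R\}$ with $0<R<\infty$, and let $f(z,w)=(p(z),q(z,w))$ be holomorphic on $D\times\mathbb{C}$ with $$p(z)=az^{\delta}+O(z^{\delta+1}),\quad a\neq 0,\ \delta\ge 2,\qquad q(z,w)=\sum_{i,j\ge 0} b_{ij}z^iw^j \text{ near } 0,\quad b_{00}=b_{01}=0,$$ so the origin is a fixed point at which both eigenvalues of $Df$ are $0$. Let $A_p$ and $A_0$ be the attracting basins of the origin for $p$ and for $f$, that is, the sets of points whose orbits stay in $D$, respectively $D\times\mathbb{C}$, and converge to the origin. If $D=\{|z|<R\}$, assume that $A_p$ is relatively compact in $D$. Write $(z_n,w_n)=f^n(z,w)$. Let $E_z$ and $E_w$ be the unions of all the preimages, under the iterates $f^n$ $(n\ge 0)$, of $\{z=0\}$ and $\{w=0\}$. Let $N(q)$ be the convex hull of $\bigcup_{b_{ij}\ne0}\{(x,y): x\ge i,\ y\ge j\}$, with vertices $(n_1,m_1),\dots,(n_s,m_s)$, where $n_1<\dots<n_s$ and $m_1>\dots>m_s$. Assume $s>1$, let $T_{s-1}$ be the $y$-intercept of the line through $(n_{s-1},m_{s-1})$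 and $(n_s,m_s)$, and put $$(\gamma,d)=(n_s,m_s),\quad l_1=\frac{n_s-n_{s-1}}{m_{s-1}-m_s},\quad \lambda=\max\{\delta,d\},\quad \alpha=\frac{\gamma}{\delta-d}\ \text{ if }\delta\ne d.$$ For $r>0$ let $A_f$ be the union of all the preimages, under the iterates $f^n$ $(n\ge0)$, of $U=\{|z|<r,\ |w|<r|z|^{l_1}\}$. With values in $[-\infty,\infty]$ and $\log 0=-\infty$, let $$G_p(z)=\lim_{n\to\infty}\frac{\log|p^n(z)|}{\delta^{n}},\quad G_z(w)=\lim_{n\to\infty}\frac{\log|w_n|}{\lambda^{n}},\quad G_z^{\alpha}(w)=\lim_{n\to\infty}\frac{1}{d^{n}}\log\left|\frac{w_n}{z_n^{\alpha}}\right|,$$ $$G_f(z,w)=\lim_{n\to\infty}\frac{\log\max\{|z_n|,|w_n|\}}{\lambda^{n}},\quad G_f^{\alpha}(z,w)=\lim_{n\to\infty}\frac{\log\max\{|z_n|^{\alpha},|w_n|\}}{\lambda^{n}},$$ where for $\alpha<0$ the quotient $|w_n/z_n^{\alpha}|$ means $|z_n|^{-\alpha}|w_n|$. Each equality below includes the existence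 of the limits involved. "On $E_w$" means at all points of $E_w$ whose whole forward orbit is defined. **Theorem.** (1) Let $\delta<T_{s-1}$. - If $\delta<d$, then $G_z=G_z^{\alpha}$ on $A_0$, and $G_f=0$ on $A_0-E_z$. - If $\delta=d$, then $G_z=-\infty$ and $G_f=G_p$ on $A_0$. - If $\delta>d\ge1$, then $G_z=\alpha G_p$ on $A_0-E_w$ and $G_z=-\infty$ on $E_w$. - If $d=0$, then $G_z=\alpha G_p$ on $A_0$. - If $\delta>d$, then $G_f^{\alpha}=\alpha G_p$ on $A_0$. (2) Let $T_{s-1}=\delta>d\ge2$. Then, for every sufficiently small $r>0$, $G_z=\alpha G_p$ on $A_f-E_w$ and $G_f^{\alpha}=\alpha G_p$ on $A_f$. Moreover $G_z=-\infty$ on $E_w$. If in addition $n_{s-1}>0$, then $G_z=\alpha G_p$ on $A_0-E_w$ and $G_f^{\alpha}=\alpha G_p$ on $A_0$. -/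

import Mathlib

open Filter Topology Set

/-- The skew product `(z, w) ↦ (p z, q (z, w))`. -/
def skewProduct (p : ℂ → ℂ) (q : ℂ × ℂ → ℂ) : ℂ × ℂ → ℂ × ℂ :=
  fun x => (p x.1, q x)

/-- The attracting basin of `x₀` for a map `g` that is defined on `Ω`: the points whose orbit
stays in `Ω` for ever and tends to `x₀`. -/
def basin {X : Type*} [TopologicalSpace X] (Ω : Set X) (g : X → X) (x₀ : X) : Set X :=
  {x | (∀ n : ℕ, g^[n] x ∈ Ω) ∧ Tendsto (fun n : ℕ => g^[n] x) atTop (𝓝 x₀)}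

/-- The union of all the preimages of `S` under the iterates of a map `g` that is defined
on `Ω` (the preimage of order `0` being `S ∩ Ω`). -/
def allPreimages {X : Type*} (Ω : Set X) (g : X → X) (S : Set X) : Set X :=
  {x | ∃ n : ℕ, (∀ k ≤ n, g^[k] x ∈ Ω) ∧ g^[n] x ∈ S}

/-- `b i j` is the coefficient of `z ^ i * w ^ j` in the power series of `q` at the origin. -/
def IsPowerSeriesCoeff (q : ℂ × ℂ → ℂ) (b : ℕ → ℕ → ℂ) : Prop :=
  ∀ᶠ x : ℂ × ℂ in 𝓝 0, HasSum (fun ij : ℕ × ℕ => b ij.1 ij.2 * x.1 ^ ij.1 * x.2 ^ ij.2) (q x)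

/-- The Newton polygon: the convex hull of the union of the quadrants
`D(i, j) = {(x, y) | x ≥ i, y ≥ j}` with `b i j ≠ 0`. -/
def newtonPolygon (b : ℕ → ℕ → ℂ) : Set (ℝ × ℝ) :=
  convexHull ℝ {v | ∃ i j : ℕ, b i j ≠ 0 ∧ (i : ℝ) ≤ v.1 ∧ (j : ℝ) ≤ v.2}

/-- `(n 1, m 1), …, (n s, m s)` are the vertices of the Newton polygon, listed so that
`n 1 < ⋯ < n s` and `m 1 > ⋯ > m s`. -/
structure IsVertexList (b : ℕ → ℕ → ℂ) (s : ℕ) (n m : ℕ → ℕ) : Prop where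
  vertices : (newtonPolygon b).extremePoints ℝ =
    {v | ∃ k : ℕ, 1 ≤ k ∧ k ≤ s ∧ v = ((n k : ℝ), (m k : ℝ))}
  n_lt : ∀ j k : ℕ, 1 ≤ j → j < k → k ≤ s → n j < n k
  m_gt : ∀ j k : ℕ, 1 ≤ j → j < k → k ≤ s → m k < m j

/-- The `y`-intercept of the line through `(n k, m k)` and `(n (k + 1), m (k + 1))`. -/
noncomputable def yIntercept (n m : ℕ → ℕ) (k : ℕ) : ℝ :=
  (m k : ℝ) + (n k : ℝ) * (((m k : ℝ) - (m (k + 1) : ℝ)) / ((n (k + 1) : ℝ) - (n k : ℝ)))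

/-- The wedge `{|z| < r, |w| < r |z| ^ l}`. -/
def wedge (l r : ℝ) : Set (ℂ × ℂ) :=
  {x | ‖x.1‖ < r ∧ ‖x.2‖ < r * ‖x.1‖ ^ l}

/-- `lim c⁻ⁿ log (u n) = g` in the extended reals, where `log 0 = -∞`. -/
def HasLogRate (c : ℕ) (u : ℕ → ENNReal) (g : EReal) : Prop :=
  Tendsto (fun n : ℕ => ((((c : ℝ) ^ n)⁻¹ : ℝ) : EReal) * ENNReal.log (u n)) atTop (𝓝 g)

/-- `G_p(z) = g`: the limit of `δ⁻ⁿ log |pⁿ(z)|` exists and equals `g`. -/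
def IsGp (p : ℂ → ℂ) (δ : ℕ) (z : ℂ) (g : EReal) : Prop :=
  HasLogRate δ (fun n => ‖p^[n] z‖ₑ) g

/-- `G_z(w) = g`: the limit of `lam⁻ⁿ log |wₙ|` exists and equals `g`,
where `(zₙ, wₙ) = fⁿ(z, w)` and `x = (z, w)`. -/
def IsGz (f : ℂ × ℂ → ℂ × ℂ) (lam : ℕ) (x : ℂ × ℂ) (g : EReal) : Prop :=
  HasLogRate lam (fun n => ‖(f^[n] x).2‖ₑ) g

/-- `G_z^α(w) = g`: the limit of `d⁻ⁿ log |wₙ / zₙ ^ α|` exists and equals `g`.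
For `α < 0` the quotient is `|zₙ| ^ (-α) * |wₙ|`, which is `0` when `zₙ = 0`. -/
def IsGzWeighted (f : ℂ × ℂ → ℂ × ℂ) (d : ℕ) (α : ℝ) (x : ℂ × ℂ) (g : EReal) : Prop :=
  HasLogRate d (fun n => ‖(f^[n] x).2‖ₑ / ‖(f^[n] x).1‖ₑ ^ α) g

/-- `G_f(z, w) = g`: the limit of `lam⁻ⁿ log max (|zₙ|, |wₙ|)` exists and equals `g`. -/
def IsGf (f : ℂ × ℂ → ℂ × ℂ) (lam : ℕ) (x : ℂ × ℂ) (g : EReal) : Prop :=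
  HasLogRate lam (fun n => max ‖(f^[n] x).1‖ₑ ‖(f^[n] x).2‖ₑ) g

/-- `G_f^α(z, w) = g`: the limit of `lam⁻ⁿ log max (|zₙ| ^ α, |wₙ|)` exists and equals `g`. -/
def IsGfWeighted (f : ℂ × ℂ → ℂ × ℂ) (lam : ℕ) (α : ℝ) (x : ℂ × ℂ) (g : EReal) : Prop :=
  HasLogRate lam (fun n => max (‖(f^[n] x).1‖ₑ ^ α) ‖(f^[n] x).2‖ₑ) g

/-!
Write `ζ = -log |z|` and `ω = -log |w|`. Near the origin `p` acts as `ζ ↦ δ ζ + O(1)`, so that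
`ζ_n / δ ^ n` converges; this is the Green function of `p`. Everything else is a comparison of `ω_n`
with `ζ_n`, governed by the last vertex `(γ, d)` of the Newton polygon and by the last edge.

If `d ≥ δ`, it is enough that `q` is `w ^ d` times a function that vanishes at the origin. For
`δ < d` the sequence `ω_n / d ^ n` is eventually monotone and `ζ_n / d ^ n` tends to `0`
(`hasLogRate_of_degree_lt`). For `δ = d` the extra factor is exponentially small in `δ ^ n`, which
forces `ω_n / δ ^ n` to `∞` (`hasLogRate_of_degree_eq`).

If `d < δ`, the monomial `z ^ γ w ^ d` dominates `q` on a thin wedge `|w| < r |z| ^ l₁`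
(`IsPowerSeriesCoeff.exists_norm_bounds_in_wedge`), because the last edge supports the polygon
(`IsVertexList.last_edge`). The wedge is forward invariant near the origin: by the exponents if `δ`
is less than the intercept of the last edge, and by `r ^ d ≪ r` if the two are equal and `d ≥ 2`. On
it `ω_{n+1} = γ ζ_n + d ω_n + O(1)`, so the deviation `α ζ_n - ω_n` is multiplied by `d < δ` up to
a bounded error, and it is negligible at the scale `δ ^ n`
(`hasLogRate_of_eventually_mem_wedge`).

An orbit in the basin that never enters the wedge satisfies `ω_n ≤ l₁ ζ_n + O(1)`, and `l₁ ≤ α`.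
For the opposite inequality there is no asymptotic formula for `q`, since cancellations may occur,
but an upper bound for `|q|` is enough. By `IsVertexList.exists_support_dichotomy` every monomial
gives either `m' ω + α (δ - m') ζ` with `m' < δ` or `(δ + ε) ω`, up to constants, and both improve
the ratio of `ω_n` to `α ζ_n` (`tendsto_weighted_diff_of_min`). When `δ` equals the intercept, this
is where `n (s - 1) > 0` is needed.

Orbits that hit `z = 0` are treated on that fibre, where `q` vanishes to order greater than the rate
in question; those that hit `w = 0` stay there when `d ≥ 1`, by the identity theorem on `D`.
-/

/-! ### The Newton polygon near its last edge -/

/-- A point of `A` that minimizes the pair `(φ, ψ)` lexicographically is an extreme point of the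
convex hull of `A`, because the lexicographic half-plane above it is convex. -/
theorem mem_extremePoints_convexHull_of_lex {A : Set (ℝ × ℝ)} {v₀ : ℝ × ℝ} (h₀ : v₀ ∈ A)
    (φ ψ : ℝ × ℝ →ₗ[ℝ] ℝ) (hinj : ∀ v, φ v = φ v₀ → ψ v = ψ v₀ → v = v₀)
    (h : ∀ v ∈ A, φ v₀ < φ v ∨ φ v = φ v₀ ∧ ψ v₀ ≤ ψ v) :
    v₀ ∈ (convexHull ℝ A).extremePoints ℝ := by
  have hconv : Convex ℝ {v | φ v₀ < φ v ∨ φ v = φ v₀ ∧ ψ v₀ ≤ ψ v} := by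
    rw [convex_iff_forall_pos]
    intro x hx y hy a c ha hc hac
    simp only [mem_ofPred_eq, map_add, map_smul, smul_eq_mul] at hx hy ⊢
    obtain rfl : c = 1 - a := by linarith
    rcases hx with hx | ⟨hx, hx'⟩ <;> rcases hy with hy | ⟨hy, hy'⟩
    · left; nlinarith
    · left; nlinarith
    · left; nlinarith
    · right; constructor
      · rw [hx, hy]; ring
      · nlinarith
  have hsub : convexHull ℝ A ⊆ {v | φ v₀ < φ v ∨ φ v = φ v₀ ∧ ψ v₀ ≤ ψ v} :=
    convexHull_min h hconv
  rw [mem_extremePoints_iff_left]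
  refine ⟨subset_convexHull ℝ A h₀, ?_⟩
  rintro x hx y hy ⟨a, c, ha, hc, hac, hv⟩
  obtain rfl : c = 1 - a := by linarith
  have h1 : a * φ x + (1 - a) * φ y = φ v₀ := by rw [← hv]; simp
  have h2 : a * ψ x + (1 - a) * ψ y = ψ v₀ := by rw [← hv]; simp
  have hφ : ∀ u ∈ convexHull ℝ A, φ v₀ ≤ φ u := fun u hu =>
    (hsub hu).elim le_of_lt fun h => h.1.ge
  have hφx : φ x = φ v₀ := by nlinarith [hφ x hx, hφ y hy]
  have hφy : φ y = φ v₀ := by nlinarith [hφ x hx, hφ y hy]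
  have hψx : ψ v₀ ≤ ψ x := ((hsub hx).resolve_left (by rw [hφx]; exact lt_irrefl _)).2
  have hψy : ψ v₀ ≤ ψ y := ((hsub hy).resolve_left (by rw [hφy]; exact lt_irrefl _)).2
  exact hinj x hφx (by nlinarith)

namespace IsVertexList

variable {b : ℕ → ℕ → ℂ} {s : ℕ} {n m : ℕ → ℕ}

/-- A point of the support that minimizes `(c₁ i + c₂ j, i)` lexicographically is a vertex of the
Newton polygon. -/
theorem exists_eq_of_lex (hv : IsVertexList b s n m) {i₀ j₀ : ℕ} (h₀ : b i₀ j₀ ≠ 0)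
    {c₁ c₂ : ℝ} (hc₁ : 0 ≤ c₁) (hc₂ : 0 < c₂)
    (h : ∀ i j, b i j ≠ 0 → c₁ * i₀ + c₂ * j₀ < c₁ * i + c₂ * j ∨
      c₁ * i + c₂ * j = c₁ * i₀ + c₂ * j₀ ∧ i₀ ≤ i) :
    ∃ k, 1 ≤ k ∧ k ≤ s ∧ n k = i₀ ∧ m k = j₀ := by
  have key : ((i₀ : ℝ), (j₀ : ℝ)) ∈ (newtonPolygon b).extremePoints ℝ := by
    refine mem_extremePoints_convexHull_of_lex ⟨i₀, j₀, h₀, le_rfl, le_rfl⟩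
      (c₁ • LinearMap.fst ℝ ℝ ℝ + c₂ • LinearMap.snd ℝ ℝ ℝ) (LinearMap.fst ℝ ℝ ℝ) ?_ ?_
    · rintro ⟨x, y⟩ h1 h2
      simp only [LinearMap.add_apply, LinearMap.smul_apply, LinearMap.fst_apply,
        LinearMap.snd_apply, smul_eq_mul] at h1 h2
      subst h2
      have : y = j₀ := mul_left_cancel₀ hc₂.ne' (by linarith)
      rw [this]
    · rintro ⟨x, y⟩ ⟨i, j, hij, hx, hy⟩
      simp only [LinearMap.add_apply, LinearMap.smul_apply, LinearMap.fst_apply,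
        LinearMap.snd_apply, smul_eq_mul] at hx hy ⊢
      have h1 := mul_le_mul_of_nonneg_left hx hc₁
      have h2 := mul_le_mul_of_nonneg_left hy hc₂.le
      rcases h i j hij with h3 | ⟨h3, h4⟩
      · left; linarith
      · have h5 : (i₀ : ℝ) ≤ x := le_trans (by exact_mod_cast h4) hx
        rcases lt_or_ge (c₁ * i₀ + c₂ * j₀) (c₁ * x + c₂ * y) with h6 | h6
        · exact Or.inl h6
        · exact Or.inr ⟨by linarith, h5⟩
  rw [hv.vertices] at key
  obtain ⟨k, hk1, hks, hk⟩ := key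
  rw [Prod.mk.injEq] at hk
  exact ⟨k, hk1, hks, by exact_mod_cast hk.1.symm, by exact_mod_cast hk.2.symm⟩

theorem mem_extremePoints (hv : IsVertexList b s n m) {k : ℕ} (h1 : 1 ≤ k) (hs : k ≤ s) :
    ((n k : ℝ), (m k : ℝ)) ∈ (newtonPolygon b).extremePoints ℝ := by
  rw [hv.vertices]; exact ⟨k, h1, hs, rfl⟩

theorem coeff_ne_zero (hv : IsVertexList b s n m) {k : ℕ} (h1 : 1 ≤ k) (hs : k ≤ s) :
    b (n k) (m k) ≠ 0 := by
  have hext := hv.mem_extremePoints h1 hs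
  obtain ⟨i, j, hij, hi, hj⟩ := extremePoints_convexHull_subset hext
  simp only at hi hj
  -- a point of a quadrant other than its corner is the midpoint of two points of the quadrant
  have hmem : ∀ x y : ℝ, (i : ℝ) ≤ x → (j : ℝ) ≤ y → (x, y) ∈ newtonPolygon b :=
    fun x y hx hy => subset_convexHull ℝ _ ⟨i, j, hij, hx, hy⟩
  have := (mem_extremePoints_iff_left.1 hext).2 ((i : ℝ), (j : ℝ)) (hmem _ _ le_rfl le_rfl)
    (2 * (n k : ℝ) - i, 2 * (m k : ℝ) - j) (hmem _ _ (by linarith) (by linarith))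
    ⟨1 / 2, 1 / 2, by norm_num, by norm_num, by norm_num, by
      ext <;> simp <;> ring⟩
  rw [Prod.mk.injEq] at this
  have h3 : i = n k := by exact_mod_cast this.1
  have h4 : j = m k := by exact_mod_cast this.2
  rwa [← h3, ← h4]

/-- The last vertex is the lexicographic minimum of `(j, i)` over the support: `q` is divisible by
`w ^ m s`, and `z ^ n s` is the leading monomial of the coefficient of `w ^ m s`. -/
theorem lowest_vertex (hv : IsVertexList b s n m) (hs : 1 ≤ s) {i j : ℕ} (hij : b i j ≠ 0) :
    m s ≤ j ∧ (j = m s → n s ≤ i) := by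
  classical
  have hex : ∃ j, ∃ i, b i j ≠ 0 := ⟨j, i, hij⟩
  obtain ⟨hi₀, hmin⟩ : (∃ i, b i (Nat.find hex) ≠ 0) ∧
    ∀ i j, b i j ≠ 0 → Nat.find hex ≤ j :=
    ⟨Nat.find_spec hex, fun i j h => Nat.find_min' hex ⟨i, h⟩⟩
  set j₀ := Nat.find hex
  have hmin' : ∀ i, b i j₀ ≠ 0 → Nat.find hi₀ ≤ i := fun i h => Nat.find_min' hi₀ h
  have hb₀ := Nat.find_spec hi₀
  set i₀ := Nat.find hi₀
  obtain ⟨k, hk1, hks, hnk, hmk⟩ := hv.exists_eq_of_lex hb₀ le_rfl one_pos (fun i j h => by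
    rcases (hmin i j h).lt_or_eq with h1 | h1
    · left; simpa using h1
    · right; subst h1; exact ⟨by simp, hmin' i h⟩)
  have hks' : k = s := by
    by_contra hne
    have h1 := hv.m_gt k s hk1 (lt_of_le_of_ne hks hne) le_rfl
    have h2 := hmin _ _ (hv.coeff_ne_zero hs le_rfl)
    omega
  subst hks'
  rw [hnk, hmk]
  exact ⟨hmin i j hij, fun h => hmin' i (h ▸ hij)⟩

/-- The line through the last two vertices supports the Newton polygon, and the points of the
support on this line do not lie to the left of the last edge. The definition of the vertex list only
names the extreme points, so the supporting edge has to be found: it is the edge from the last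
vertex of greatest slope `(n s - i) / (j - m s)`, and strict convexity shows that its other endpoint
is the vertex number `s - 1`. -/
theorem last_edge (hv : IsVertexList b s n m) (hs : 1 < s) {l : ℝ}
    (hl : l = ((n s : ℝ) - (n (s - 1) : ℝ)) / ((m (s - 1) : ℝ) - (m s : ℝ)))
    {i j : ℕ} (hij : b i j ≠ 0) :
    (n s : ℝ) + l * m s ≤ i + l * j ∧ ((n s : ℝ) + l * m s = i + l * j → n (s - 1) ≤ i) := by
  have hn := hv.n_lt (s - 1) s (by omega) (by omega) le_rfl
  have hm := hv.m_gt (s - 1) s (by omega) (by omega) le_rfl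
  have hnR : (n (s - 1) : ℝ) < n s := by exact_mod_cast hn
  have hmR : (m s : ℝ) < m (s - 1) := by exact_mod_cast hm
  have hlpos : 0 < l := by rw [hl]; exact div_pos (by linarith) (by linarith)
  have hedge : (n (s - 1) : ℝ) + l * m (s - 1) = n s + l * m s := by
    rw [hl]; field_simp [(sub_pos.2 hmR).ne']; ring
  -- the competitors: points of the support above the last vertex, on or below the last edge
  set F : Set (ℕ × ℕ) := {v | b v.1 v.2 ≠ 0 ∧ m s < v.2 ∧ (v.1 : ℝ) + l * v.2 ≤ n s + l * m s}
  have hFfin : F.Finite := by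
    obtain ⟨N, hN⟩ := exists_nat_ge ((n s : ℝ) + l * m s)
    obtain ⟨N', hN'⟩ := exists_nat_ge (((n s : ℝ) + l * m s) / l)
    refine ((finite_Iic N).prod (finite_Iic N')).subset ?_
    rintro ⟨i, j⟩ ⟨-, -, h⟩
    simp only at h
    have hi0 : (0 : ℝ) ≤ i := i.cast_nonneg
    have hj0 : (0 : ℝ) ≤ l * j := mul_nonneg hlpos.le j.cast_nonneg
    refine ⟨?_, ?_⟩
    · have : (i : ℝ) ≤ N := by linarith
      exact mem_Iic.2 (by exact_mod_cast this)
    · have : (j : ℝ) ≤ N' := le_trans (by rw [le_div_iff₀ hlpos]; linarith) hN'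
      exact mem_Iic.2 (by exact_mod_cast this)
  have hmem : (n (s - 1), m (s - 1)) ∈ F :=
    ⟨hv.coeff_ne_zero (by omega) (by omega), hm, hedge.le⟩
  set S : ℕ × ℕ → ℝ := fun v => ((n s : ℝ) - v.1) / ((v.2 : ℝ) - m s)
  obtain ⟨⟨i₀, j₀⟩, hv₀, hmax⟩ := Set.exists_max_image F
    (fun v => toLex (S v, v.2)) hFfin ⟨_, hmem⟩
  obtain ⟨hb₀, hj₀, hline₀⟩ := hv₀
  simp only at hb₀ hj₀ hline₀
  have hj₀R : (m s : ℝ) < j₀ := by exact_mod_cast hj₀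
  set L := S (i₀, j₀) with hL
  have hSL : ∀ i j : ℕ, (i, j) ∈ F → S (i, j) ≤ L ∧ (S (i, j) = L → j ≤ j₀) := by
    intro i j h
    have := hmax _ h
    rw [Prod.Lex.toLex_le_toLex] at this
    rcases this with h1 | ⟨h1, h2⟩
    · exact ⟨h1.le, fun h => absurd h h1.ne⟩
    · exact ⟨h1.le, fun _ => h2⟩
  have hLl : l ≤ L := by
    have := (hSL _ _ hmem).1
    rwa [show S (n (s - 1), m (s - 1)) = l from hl.symm] at this
  have hLpos : 0 < L := hlpos.trans_le hLl
  have hL₀ : (i₀ : ℝ) + L * j₀ = n s + L * m s := by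
    have : L * ((j₀ : ℝ) - m s) = n s - i₀ := div_mul_cancel₀ _ (sub_pos.2 hj₀R).ne'
    linarith
  -- every point of the support lies on or above the line through `(n s, m s)` and `(i₀, j₀)`
  have hall : ∀ i j, b i j ≠ 0 → (n s : ℝ) + L * m s < i + L * j ∨
      (i : ℝ) + L * j = n s + L * m s ∧ i₀ ≤ i := by
    intro i j h
    obtain ⟨h1, h2⟩ := hv.lowest_vertex hs.le h
    rcases h1.eq_or_lt with h3 | h3
    · have h4 : (n s : ℝ) ≤ i := by exact_mod_cast h2 h3.symm
      rw [← h3]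
      rcases h4.lt_or_eq with h5 | h5
      · left; linarith
      · right
        refine ⟨by linarith, ?_⟩
        have : (i₀ : ℝ) ≤ i := by nlinarith
        exact_mod_cast this
    · have h3R : (m s : ℝ) < j := by exact_mod_cast h3
      by_cases hF : (i, j) ∈ F
      · obtain ⟨h4, h5⟩ := hSL i j hF
        have h6 : S (i, j) * ((j : ℝ) - m s) = n s - i := div_mul_cancel₀ _ (sub_pos.2 h3R).ne'
        rcases h4.lt_or_eq with h7 | h7
        · left
          have := mul_lt_mul_of_pos_right h7 (sub_pos.2 h3R)
          linarith
        · right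
          have h8 : (j : ℝ) ≤ j₀ := by exact_mod_cast h5 h7
          rw [h7] at h6
          refine ⟨by linarith, ?_⟩
          have : (i₀ : ℝ) ≤ i := by nlinarith
          exact_mod_cast this
      · left
        have h4 : (n s : ℝ) + l * m s < i + l * j := by
          by_contra hcon
          exact hF ⟨h, h3, not_lt.1 hcon⟩
        nlinarith
  obtain ⟨k, hk1, hks, hnk, hmk⟩ := hv.exists_eq_of_lex hb₀ zero_le_one hLpos (fun i j h => by
    simpa only [one_mul, hL₀] using hall i j h)
  have hks' : k = s - 1 := by
    by_contra hne
    have hkne : k ≠ s := by rintro rfl; omega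
    -- otherwise the vertex before the last one lies above the segment from `(i₀, j₀)` to the
    -- last vertex, hence inside a translate of it that is contained in the polygon
    have hk : k < s - 1 := by omega
    have hnlt : (i₀ : ℝ) < n (s - 1) := by
      rw [← hnk]; exact_mod_cast hv.n_lt k (s - 1) hk1 hk (by omega)
    set t : ℝ := ((n (s - 1) : ℝ) + L * m (s - 1) - (n s + L * m s)) / L with ht
    have htL : L * t = (n (s - 1) : ℝ) + L * m (s - 1) - (n s + L * m s) := by
      rw [ht]; field_simp
    have ht0 : 0 ≤ t := by
      refine div_nonneg ?_ hLpos.le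
      rcases hall _ _ hmem.1 with h | h <;> simp only at h
      · linarith
      · linarith [h.1]
    have hden : (0 : ℝ) < n s - i₀ := by linarith
    have := (mem_extremePoints_iff_left.1
      (hv.mem_extremePoints (k := s - 1) (by omega) (by omega))).2
      ((i₀ : ℝ), (j₀ : ℝ) + t) (subset_convexHull ℝ _ ⟨i₀, j₀, hb₀, le_rfl, by simpa using ht0⟩)
      ((n s : ℝ), (m s : ℝ) + t) (subset_convexHull ℝ _
        ⟨n s, m s, hv.coeff_ne_zero hs.le le_rfl, le_rfl, by simpa using ht0⟩)
      ⟨((n s : ℝ) - n (s - 1)) / (n s - i₀), ((n (s - 1) : ℝ) - i₀) / (n s - i₀),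
        div_pos (by linarith) hden, div_pos (by linarith) hden, by field_simp; ring, by
          ext
          · simp; field_simp; ring
          · have e1 : (m (s - 1) : ℝ) = t + (n s - n (s - 1)) / L + m s := by
              field_simp; linarith
            have e2 : (n s : ℝ) - i₀ = L * (j₀ - m s) := by linarith
            have e3 : (0 : ℝ) < j₀ - m s := by linarith
            simp only [Prod.smul_mk, smul_eq_mul, Prod.mk_add_mk]
            rw [e1, show (i₀ : ℝ) = n s - L * (j₀ - m s) by linarith]
            have : (n s : ℝ) - (n s - L * (j₀ - m s)) = L * (j₀ - m s) := by ring
            rw [this]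
            field_simp
            ring⟩
    rw [Prod.mk.injEq] at this
    exact hnlt.ne this.1
  rw [hks'] at hnk hmk
  have hLeq : L = l := by rw [hl, hnk, hmk, hL]
  rw [← hLeq, hnk]
  rcases hall i j hij with h | ⟨h, h'⟩
  · exact ⟨h.le, fun h1 => absurd h1 h.ne⟩
  · exact ⟨h.ge, fun _ => h'⟩

/-- The form in which the Newton polygon enters the estimate outside the wedge. Relative to a
vertex `(n', m')` with `m' < δ` and `n' = α * (δ - m')`, every
monomial of `q` is either on the right of this vertex and above the last edge, or has weighted degree
greater than `l * δ` by a definite amount. If `δ` is less than the intercept then `(n', m')` is the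
last vertex; if it equals the intercept then it is the last but one. -/
theorem exists_support_dichotomy (hv : IsVertexList b s n m) (hs : 1 < s) {l α : ℝ} (hl0 : 0 < l)
    (hl : l = ((n s : ℝ) - (n (s - 1) : ℝ)) / ((m (s - 1) : ℝ) - (m s : ℝ)))
    {δ : ℕ} (hdδ : m s < δ) (hα : α * δ = n s + α * m s)
    (h : l * δ < n s + l * m s ∨ l * δ = n s + l * m s ∧ 0 < n (s - 1)) :
    ∃ (n' m' : ℕ) (ε : ℝ), 0 < ε ∧ 0 < n' ∧ m' < δ ∧ (n' : ℝ) = α * (δ - m') ∧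
      ∀ i j, b i j ≠ 0 → (n' ≤ i ∧ (n' : ℝ) + l * m' ≤ i + l * j) ∨
        (i ≤ n' ∧ l * (δ + ε) ≤ i + l * j) := by
  have hn := hv.n_lt (s - 1) s (by omega) (by omega) le_rfl
  have hm := hv.m_gt (s - 1) s (by omega) (by omega) le_rfl
  have hdδR : (m s : ℝ) < δ := by exact_mod_cast hdδ
  rcases h with h | ⟨h, hpos⟩
  · refine ⟨n s, m s, ((n s : ℝ) + l * m s) / l - δ, ?_, by omega, hdδ, by linarith, ?_⟩
    · rw [sub_pos, lt_div_iff₀ hl0]; linarith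
    · intro i j hij
      have hedge := (hv.last_edge hs hl hij).1
      rcases le_total (n s) i with h1 | h1
      · exact Or.inl ⟨h1, hedge⟩
      · refine Or.inr ⟨h1, le_of_eq_of_le ?_ hedge⟩
        field_simp
        ring
  · have hmR : (m s : ℝ) < m (s - 1) := by exact_mod_cast hm
    have hedge : (n (s - 1) : ℝ) + l * m (s - 1) = n s + l * m s := by
      rw [hl]; field_simp [(sub_pos.2 hmR).ne']; ring
    have hαl : α = l := by
      have : (α - l) * (δ - m s) = 0 := by linarith
      rcases mul_eq_zero.1 this with h1 | h1 <;> linarith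
    have hposR : (0 : ℝ) < n (s - 1) := by exact_mod_cast hpos
    have hm' : (m (s - 1) : ℝ) < δ := by
      have : l * m (s - 1) < l * δ := by linarith
      exact lt_of_mul_lt_mul_left this hl0.le
    -- points of the support to the left of the last edge lie above it, and by discreteness
    -- they do so uniformly
    have hgap : ∀ v ∈ Finset.range (n (s - 1)) ×ˢ Finset.range (δ + 1), b v.1 v.2 ≠ 0 →
        0 < ((v.1 : ℝ) + l * v.2) / l - δ := by
      intro v hv' hb
      rw [sub_pos, lt_div_iff₀ hl0, mul_comm, h]
      obtain ⟨h1, h2⟩ := hv.last_edge hs hl hb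
      refine lt_of_le_of_ne h1 fun h3 => ?_
      have := h2 h3
      have := Finset.mem_range.1 (Finset.mem_product.1 hv').1
      omega
    have hev : ∀ᶠ ε in 𝓝[>] (0 : ℝ), ∀ v ∈ Finset.range (n (s - 1)) ×ˢ Finset.range (δ + 1),
        b v.1 v.2 ≠ 0 → ε < ((v.1 : ℝ) + l * v.2) / l - δ := by
      refine (Filter.eventually_all_finset _).2 fun v hv' => ?_
      by_cases hb : b v.1 v.2 ≠ 0
      · exact ((eventually_lt_nhds (hgap v hv' hb)).filter_mono nhdsWithin_le_nhds).mono
          fun ε hε _ => hε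
      · exact Eventually.of_forall fun ε h => absurd h hb
    obtain ⟨ε, hε, hε1, hε0⟩ := (hev.and (((eventually_lt_nhds one_pos).filter_mono
      nhdsWithin_le_nhds).and self_mem_nhdsWithin)).exists
    refine ⟨n (s - 1), m (s - 1), ε, hε0, hpos, by exact_mod_cast hm', ?_, ?_⟩
    · rw [hαl]; linarith
    · intro i j hij
      rcases le_or_gt (n (s - 1)) i with h1 | h1
      · exact Or.inl ⟨h1, hedge.le.trans (hv.last_edge hs hl hij).1⟩
      · refine Or.inr ⟨h1.le, ?_⟩
        rcases lt_or_ge j (δ + 1) with h2 | h2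
        · have h3 := hε (i, j) (Finset.mem_product.2 ⟨Finset.mem_range.2 h1,
            Finset.mem_range.2 h2⟩) hij
          rw [lt_sub_iff_add_lt, lt_div_iff₀ hl0] at h3
          simp only at h3
          linarith
        · have h3 : (δ : ℝ) + 1 ≤ j := by exact_mod_cast h2
          have h4 : l * (δ + ε) ≤ l * j := mul_le_mul_of_nonneg_left (by linarith) hl0.le
          linarith [(Nat.cast_nonneg i : (0 : ℝ) ≤ i)]

end IsVertexList

/-! ### Real sequences with approximate linear recursions -/

theorem tendsto_zero_of_le_mul_add {v e : ℕ → ℝ} {θ : ℝ} (hθ₀ : 0 ≤ θ) (hθ₁ : θ < 1)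
    (hv : ∀ᶠ n in atTop, 0 ≤ v n) (he : Tendsto e atTop (𝓝 0))
    (h : ∀ᶠ n in atTop, v (n + 1) ≤ θ * v n + e n) : Tendsto v atTop (𝓝 0) := by
  rw [Metric.tendsto_atTop]
  intro ε hε
  have h1 : ∀ᶠ n in atTop, e n ≤ (1 - θ) * (ε / 2) :=
    he.eventually_le_const (by have := sub_pos.2 hθ₁; positivity)
  obtain ⟨N, hN⟩ := eventually_atTop.1 (hv.and (h.and h1))
  have hind : ∀ k, v (N + k) ≤ θ ^ k * v N + ε / 2 := by
    intro k
    induction k with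
    | zero => simp; linarith
    | succ k ih =>
      obtain ⟨-, h2, h3⟩ := hN (N + k) (by omega)
      have h4 := mul_le_mul_of_nonneg_left ih hθ₀
      calc v (N + (k + 1)) ≤ θ * v (N + k) + e (N + k) := h2
        _ ≤ θ ^ (k + 1) * v N + ε / 2 := by rw [pow_succ]; linarith
  have hlim : Tendsto (fun k => θ ^ k * v N) atTop (𝓝 0) := by
    simpa using (tendsto_pow_atTop_nhds_zero_of_lt_one hθ₀ hθ₁).mul_const (v N)
  obtain ⟨K, hK⟩ := eventually_atTop.1 (hlim.eventually_lt_const (half_pos hε))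
  refine ⟨N + K, fun n hn => ?_⟩
  obtain ⟨k, rfl⟩ := Nat.exists_eq_add_of_le (le_trans (Nat.le_add_right N K) hn)
  rw [Real.dist_eq, sub_zero, abs_of_nonneg (hN _ (by omega)).1]
  linarith [hind k, hK k (by omega)]

/-- A divergent sequence that grows at least by the factor `L`, up to a bounded error, grows at
least like `L ^ n`. -/
theorem exists_pos_mul_pow_le {ω : ℕ → ℝ} {L C : ℝ} (hL : 1 < L) (hω : Tendsto ω atTop atTop)
    (h : ∀ᶠ n in atTop, L * ω n - C ≤ ω (n + 1)) :
    ∃ c, 0 < c ∧ ∀ᶠ n in atTop, c * L ^ n ≤ ω n := by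
  have hL' : 0 < L - 1 := sub_pos.2 hL
  have hL0 : 0 < L := by linarith
  -- `K` is a fixed point of `t ↦ L t - |C|`
  set K := |C| / (L - 1) with hK
  have hKL : (L - 1) * K = |C| := by rw [hK]; field_simp
  have hK0 : 0 ≤ K := by positivity
  obtain ⟨N, hN⟩ := eventually_atTop.1 (h.and (hω.eventually_ge_atTop (K + 1)))
  have hind : ∀ k, L ^ k ≤ ω (N + k) - K := by
    intro k
    induction k with
    | zero => simp; linarith [(hN N le_rfl).2]
    | succ k ih =>
      have h1 := (hN (N + k) (by omega)).1
      have h2 := mul_le_mul_of_nonneg_left ih hL0.le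
      have h3 := le_abs_self C
      have h4 : ω (N + (k + 1)) = ω (N + k + 1) := rfl
      rw [pow_succ, h4]
      linarith
  refine ⟨(L ^ N)⁻¹, by positivity, eventually_atTop.2 ⟨N, fun n hn => ?_⟩⟩
  obtain ⟨k, rfl⟩ := Nat.exists_eq_add_of_le hn
  rw [pow_add, inv_mul_cancel_left₀ (by positivity)]
  linarith [hind k]

theorem tendsto_const_div_pow_of_one_lt {L : ℝ} (hL : 1 < L) (C : ℝ) :
    Tendsto (fun n : ℕ => C / L ^ n) atTop (𝓝 0) :=
  (tendsto_pow_atTop_atTop_of_one_lt hL).const_div_atTop C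

theorem tendsto_div_pow_atTop {ω : ℕ → ℝ} {L c C : ℝ} (hL : 1 < L) (hc : 0 < c)
    (h : ∀ᶠ n in atTop, L * ω n + c * L ^ n - C ≤ ω (n + 1)) :
    Tendsto (fun n => ω n / L ^ n) atTop atTop := by
  have hL0 : 0 < L := by linarith
  obtain ⟨N, hN⟩ := eventually_atTop.1
    (h.and ((tendsto_const_div_pow_of_one_lt hL C).eventually_le_const (half_pos hc)))
  have hstep : ∀ n, N ≤ n → ω n / L ^ n + c / (2 * L) ≤ ω (n + 1) / L ^ (n + 1) := by
    intro n hn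
    obtain ⟨h1, h2⟩ := hN n hn
    have hp : 0 < L ^ n := by positivity
    rw [div_le_iff₀ hp] at h2
    rw [le_div_iff₀ (by positivity), pow_succ]
    have : (ω n / L ^ n + c / (2 * L)) * (L ^ n * L) = L * ω n + c / 2 * L ^ n := by
      field_simp
    linarith
  have hind : ∀ k : ℕ, ω N / L ^ N + k * (c / (2 * L)) ≤ ω (k + N) / L ^ (k + N) := by
    intro k
    induction k with
    | zero => simp
    | succ k ih =>
      have := hstep (k + N) (by omega)
      rw [show k + 1 + N = k + N + 1 by omega]
      push_cast
      linarith
  rw [← tendsto_add_atTop_iff_nat N]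
  exact tendsto_atTop_mono hind (tendsto_atTop_add_const_left _ _
    (tendsto_natCast_atTop_atTop.atTop_mul_const (by positivity)))

theorem tendsto_div_pow_atTop_of_min {ω ζ : ℕ → ℝ} {L c C : ℝ} (hL : 1 < L) (hc : 0 < c)
    (hω : Tendsto ω atTop atTop) (hζ : ∀ᶠ n in atTop, c * L ^ n ≤ ζ n)
    (h : ∀ᶠ n in atTop, L * ω n + min (ω n) (ζ n) - C ≤ ω (n + 1)) :
    Tendsto (fun n => ω n / L ^ n) atTop atTop := by
  obtain ⟨c', hc', h'⟩ := exists_pos_mul_pow_le (C := C) hL hω (by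
    filter_upwards [hζ, h, hω.eventually_ge_atTop 0] with n h1 h2 h3
    have : 0 ≤ ζ n := le_trans (by positivity) h1
    linarith [le_min h3 this])
  refine tendsto_div_pow_atTop (c := min c c') (C := C) hL (lt_min hc hc') ?_
  filter_upwards [hζ, h, h'] with n h1 h2 h3
  have hp : 0 < L ^ n := by positivity
  have h4 : min c c' * L ^ n ≤ min (ω n) (ζ n) := le_min
    (le_trans (mul_le_mul_of_nonneg_right (min_le_right _ _) hp.le) h3)
    (le_trans (mul_le_mul_of_nonneg_right (min_le_left _ _) hp.le) h1)
  linarith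

/-- A sequence multiplied by `L` at each step, up to a bounded error, has a limit after division by
`L ^ n`. -/
theorem exists_tendsto_div_pow {ζ : ℕ → ℝ} {L C : ℝ} (hL : 1 < L)
    (h : ∀ᶠ n in atTop, |ζ (n + 1) - L * ζ n| ≤ C) :
    ∃ G, Tendsto (fun n => ζ n / L ^ n) atTop (𝓝 G) := by
  have hL0 : 0 < L := by linarith
  obtain ⟨N, hN⟩ := eventually_atTop.1 h
  have hdist : ∀ k, dist (ζ (k + N) / L ^ (k + N)) (ζ (k + 1 + N) / L ^ (k + 1 + N)) ≤
      C / L ^ (N + 1) * L⁻¹ ^ k := by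
    intro k
    have h1 := hN (k + N) (by omega)
    have h2 : ζ (k + 1 + N) / L ^ (k + 1 + N) - ζ (k + N) / L ^ (k + N) =
        (ζ (k + N + 1) - L * ζ (k + N)) / L ^ (k + N + 1) := by
      rw [show k + 1 + N = k + N + 1 by omega, pow_succ]; field_simp
    rw [dist_comm, Real.dist_eq, h2, abs_div, abs_of_pos (by positivity : 0 < L ^ (k + N + 1)),
      show k + N + 1 = (N + 1) + k by omega, pow_add, inv_pow, ← div_eq_mul_inv, div_div]
    rw [show k + N + 1 = (N + 1) + k by omega] at h1
    gcongr
  obtain ⟨G, hG⟩ := cauchySeq_tendsto_of_complete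
    (cauchySeq_of_le_geometric L⁻¹ _ (inv_lt_one_of_one_lt₀ hL) hdist)
  exact ⟨G, (tendsto_add_atTop_iff_nat N).1 hG⟩

/-- The dynamics inside the wedge in the coordinates `ζ = -log |z|`, `ω = -log |w|`. The relation
`α * L = γ + α * d` makes `α ζ - ω` an eigenvector of eigenvalue `d < L`. -/
theorem tendsto_weighted_diff_of_monomial {ζ ω : ℕ → ℝ} {L α γ d C C' : ℝ} (hL : 1 < L)
    (hd₀ : 0 ≤ d) (hd : d < L) (hα : α * L = γ + α * d)
    (hζ : ∀ᶠ n in atTop, |ζ (n + 1) - L * ζ n| ≤ C)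
    (hω : ∀ᶠ n in atTop, |ω (n + 1) - (γ * ζ n + d * ω n)| ≤ C') :
    Tendsto (fun n => (α * ζ n - ω n) / L ^ n) atTop (𝓝 0) := by
  have hL0 : 0 < L := by linarith
  rw [tendsto_zero_iff_abs_tendsto_zero]
  refine tendsto_zero_of_le_mul_add (θ := d / L) (e := fun n => ((|α| * C + C') / L) / L ^ n)
    (by positivity) ((div_lt_one hL0).2 hd) (Eventually.of_forall fun n => abs_nonneg _)
    (tendsto_const_div_pow_of_one_lt hL _) ?_
  filter_upwards [hζ, hω] with n h1 h2
  have hp : 0 < L ^ n := by positivity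
  have h3 : α * ζ (n + 1) - ω (n + 1) = d * (α * ζ n - ω n) + α * (ζ (n + 1) - L * ζ n) -
      (ω (n + 1) - (γ * ζ n + d * ω n)) := by linear_combination ζ n * hα
  have h4 : |α * ζ (n + 1) - ω (n + 1)| ≤ d * |α * ζ n - ω n| + (|α| * C + C') := by
    rw [h3]
    refine (abs_sub _ _).trans ?_
    refine (add_le_add_left (abs_add_le _ _) _).trans ?_
    rw [abs_mul, abs_mul, abs_of_nonneg hd₀]
    have := mul_le_mul_of_nonneg_left h1 (abs_nonneg α)
    linarith
  simp only [Function.comp, abs_div, abs_of_pos hp, abs_of_pos (pow_pos hL0 (n + 1))]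
  rw [div_le_iff₀ (by positivity), pow_succ]
  calc _ ≤ _ := h4
    _ = _ := by field_simp

/-- The dynamics of an orbit that stays outside the wedge, in the coordinates `ζ = -log |z|`,
`ω = -log |w|`. Being outside gives `ω ≤ l ζ + O(1) ≤ α ζ + O(1)`; conversely the positive part of
`(α ζ - ω) / L ^ n` is contracted at each step, in the first alternative of the minimum since
`μ < L`, in the second since `ω` is bounded below by a multiple of `L ^ n`. -/
theorem tendsto_weighted_diff_of_min {ζ ω : ℕ → ℝ} {L α l μ ε C C₀ C₁ : ℝ} (hL : 1 < L)
    (hl : 0 < l) (hlα : l ≤ α) (hμ₀ : 0 ≤ μ) (hμ : μ < L) (hε : 0 < ε)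
    (hζt : Tendsto ζ atTop atTop) (hωt : Tendsto ω atTop atTop)
    (hζ : ∀ᶠ n in atTop, |ζ (n + 1) - L * ζ n| ≤ C)
    (hout : ∀ᶠ n in atTop, ω n ≤ l * ζ n + C₀)
    (hω : ∀ᶠ n in atTop,
      min (μ * ω n + α * (L - μ) * ζ n) ((L + ε) * ω n) - C₁ ≤ ω (n + 1)) :
    Tendsto (fun n => (α * ζ n - ω n) / L ^ n) atTop (𝓝 0) := by
  have hL0 : 0 < L := by linarith
  have hα0 : 0 < α := hl.trans_le hlα
  obtain ⟨c, hc, hcω⟩ := exists_pos_mul_pow_le (C := C₁ + (L - μ) * |C₀|) hL hωt (by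
    filter_upwards [hout, hω, hζt.eventually_ge_atTop 0, hωt.eventually_ge_atTop 0]
      with n h1 h2 h3 h4
    have h5 : L * ω n - (L - μ) * |C₀| ≤ μ * ω n + α * (L - μ) * ζ n := by
      have h6 : l * ζ n ≤ α * ζ n := mul_le_mul_of_nonneg_right hlα h3
      have h7 := mul_le_mul_of_nonneg_left (show ω n - |C₀| ≤ α * ζ n by
        linarith [le_abs_self C₀]) (sub_nonneg.2 hμ.le)
      linarith
    have h6 : L * ω n - (L - μ) * |C₀| ≤ (L + ε) * ω n := by
      have := mul_nonneg hε.le h4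
      have := mul_nonneg (sub_nonneg.2 hμ.le) (abs_nonneg C₀)
      linarith
    linarith [le_min h5 h6])
  obtain ⟨G, hG⟩ := exists_tendsto_div_pow hL hζ
  -- an upper bound for the positive part of the weighted difference
  set A := max (α * (G + 1)) (c * 1) with hA
  have hApos : 0 < A := lt_of_lt_of_le (by positivity) (le_max_right _ _)
  have hζA : ∀ᶠ n in atTop, α * ζ n ≤ A * L ^ n := by
    filter_upwards [hG.eventually_le_const (lt_add_one G)] with n h
    rw [div_le_iff₀ (by positivity)] at h
    have := mul_le_mul_of_nonneg_left h hα0.le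
    have h2 : α * (G + 1) * L ^ n ≤ A * L ^ n :=
      mul_le_mul_of_nonneg_right (le_max_left _ _) (by positivity)
    linarith
  set θ := max (μ / L) (1 - ε * c / (A * L)) with hθ
  have hθ0 : 0 ≤ θ := le_trans (by positivity) (le_max_left _ _)
  have hθ1 : θ < 1 := max_lt ((div_lt_one hL0).2 hμ) (by
    have : 0 < ε * c / (A * L) := by positivity
    linarith)
  have hpos : Tendsto (fun n => max ((α * ζ n - ω n) / L ^ n) 0) atTop (𝓝 0) := by
    refine tendsto_zero_of_le_mul_add (e := fun n => ((α * C + |C₁|) / L) / L ^ n) hθ0 hθ1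
      (Eventually.of_forall fun n => le_max_right _ _) (tendsto_const_div_pow_of_one_lt hL _) ?_
    filter_upwards [hζ, hω, hcω, hζA, hωt.eventually_ge_atTop 0] with n h1 h2 h3 h4 h5
    have hp : 0 < L ^ n := by positivity
    have hC : 0 ≤ C := le_trans (abs_nonneg _) h1
    set v := max (α * ζ n - ω n) 0 with hv
    have hv0 : 0 ≤ v := le_max_right _ _
    have hvA : v ≤ A * L ^ n := max_le (by linarith) (by positivity)
    have hvle : α * ζ n - ω n ≤ v := le_max_left _ _
    have h6 : α * ζ (n + 1) ≤ α * (L * ζ n) + α * C := by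
      have := mul_le_mul_of_nonneg_left (abs_le.1 h1).2 hα0.le
      linarith
    have hθμ : μ ≤ θ * L := by rw [← div_le_iff₀ hL0]; exact le_max_left _ _
    have hθε : L * v - ε * ω n ≤ θ * L * v := by
      have h7 : (1 - ε * c / (A * L)) * (L * v) ≤ θ * (L * v) :=
        mul_le_mul_of_nonneg_right (le_max_right _ _) (by positivity)
      have h8 : (1 - ε * c / (A * L)) * (L * v) = L * v - ε * c * v / A := by
        field_simp
      have h9 : ε * c * v / A ≤ ε * ω n := by
        rw [div_le_iff₀ hApos]
        have h10 := mul_le_mul_of_nonneg_left hvA (mul_pos hε hc).le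
        have h11 := mul_le_mul_of_nonneg_left h3 (mul_pos hε hApos).le
        linarith
      linarith
    have h7 : max (α * ζ (n + 1) - ω (n + 1)) 0 ≤ θ * L * v + (α * C + |C₁|) := by
      refine max_le ?_ (by positivity)
      have h12 := le_abs_self C₁
      rcases min_choice (μ * ω n + α * (L - μ) * ζ n) ((L + ε) * ω n) with h8 | h8
      · rw [h8] at h2
        have h9 : μ * (α * ζ n - ω n) ≤ θ * L * v :=
          (mul_le_mul_of_nonneg_left hvle hμ₀).trans (mul_le_mul_of_nonneg_right hθμ hv0)
        linarith
      · rw [h8] at h2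
        have h9 := mul_le_mul_of_nonneg_left hvle hL0.le
        linarith
    have hdiv : ∀ (x : ℝ) (k : ℕ), max (x / L ^ k) 0 = max x 0 / L ^ k := fun x k => by
      rw [← zero_div (L ^ k), max_div_div_right (by positivity), zero_div]
    rw [hdiv, hdiv, div_le_iff₀ (by positivity), pow_succ]
    calc _ ≤ _ := h7
      _ = _ := by rw [hv]; field_simp
  refine tendsto_of_tendsto_of_tendsto_of_le_of_le' (tendsto_const_div_pow_of_one_lt hL (-C₀)) hpos ?_
    (Eventually.of_forall fun n => le_max_left _ _)
  filter_upwards [hout, hζt.eventually_ge_atTop 0] with n h1 h2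
  have := mul_le_mul_of_nonneg_right hlα h2
  gcongr
  linarith

/-! ### Logarithmic rates -/

namespace HasLogRate

variable {c : ℕ} {u v : ℕ → ENNReal} {g h : EReal}

theorem bot_of_eventually_zero (hc : c ≠ 0) (hu : ∀ᶠ n in atTop, u n = 0) :
    HasLogRate c u ⊥ := by
  refine Tendsto.congr' ?_ tendsto_const_nhds
  filter_upwards [hu] with n hn
  rw [hn, ENNReal.log_zero, EReal.coe_mul_bot_of_pos (by positivity)]

theorem max (hu : HasLogRate c u g) (hv : HasLogRate c v h) :
    HasLogRate c (fun n => max (u n) (v n)) (max g h) := by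
  refine (Tendsto.max hu hv).congr fun n => ?_
  have hmono : Monotone fun x => ((((c : ℝ) ^ n)⁻¹ : ℝ) : EReal) * ENNReal.log x :=
    fun x y hxy => mul_le_mul_of_nonneg_left (ENNReal.log_monotone hxy)
      (by exact_mod_cast (by positivity : (0 : ℝ) ≤ ((c : ℝ) ^ n)⁻¹))
  exact (hmono.map_max).symm

theorem rpow {α : ℝ} (hα : α ≠ 0) (hu : HasLogRate c u g) :
    HasLogRate c (fun n => u n ^ α) (α * g) := by
  have hcont : ContinuousAt (fun x : EReal => (α : EReal) * x) g :=
    (EReal.continuousAt_mul (p := ((α : EReal), g)) (Or.inl (by simpa using hα))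
      (Or.inl (by simpa using hα)) (Or.inl (EReal.coe_ne_bot α))
      (Or.inl (EReal.coe_ne_top α))).comp (by fun_prop)
  refine (hcont.tendsto.comp hu).congr fun n => ?_
  simp only [Function.comp, ENNReal.log_rpow]
  rw [mul_left_comm]

end HasLogRate

theorem log_enorm_of_ne_zero {w : ℂ} (hw : w ≠ 0) :
    ENNReal.log ‖w‖ₑ = ((Real.log ‖w‖ : ℝ) : EReal) := by
  rw [ENNReal.log_pos_real (by simpa using hw) (by simp)]
  simp

theorem hasLogRate_enorm_iff {c : ℕ} {w : ℕ → ℂ} (hw : ∀ᶠ n in atTop, w n ≠ 0) {g : EReal} :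
    HasLogRate c (fun n => ‖w n‖ₑ) g ↔
      Tendsto (fun n => ((Real.log ‖w n‖ / (c : ℝ) ^ n : ℝ) : EReal)) atTop (𝓝 g) := by
  refine tendsto_congr' ?_
  filter_upwards [hw] with n hn
  rw [log_enorm_of_ne_zero hn, ← EReal.coe_mul, inv_mul_eq_div]

theorem HasLogRate.of_tendsto_weighted_diff {δ : ℕ} {α G : ℝ} {z w : ℕ → ℂ}
    (hG : Tendsto (fun n => Real.log ‖z n‖ / (δ : ℝ) ^ n) atTop (𝓝 G))
    (hwne : ∀ᶠ n in atTop, w n ≠ 0)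
    (h : Tendsto (fun n => (α * -Real.log ‖z n‖ - -Real.log ‖w n‖) / (δ : ℝ) ^ n) atTop (𝓝 0)) :
    HasLogRate δ (fun n => ‖w n‖ₑ) ((α : EReal) * (G : EReal)) := by
  rw [hasLogRate_enorm_iff hwne, ← EReal.coe_mul, EReal.tendsto_coe]
  have := (hG.const_mul α).add h
  rw [add_zero] at this
  exact this.congr fun n => by ring

theorem HasLogRate.div_rpow {c : ℕ} {α : ℝ} {z w : ℕ → ℂ} {g : EReal}
    (hw : HasLogRate c (fun n => ‖w n‖ₑ) g) (hzne : ∀ᶠ n in atTop, z n ≠ 0)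
    (hz : Tendsto (fun n => Real.log ‖z n‖ / (c : ℝ) ^ n) atTop (𝓝 0)) :
    HasLogRate c (fun n => ‖w n‖ₑ / ‖z n‖ₑ ^ α) g := by
  have hz' : Tendsto (fun n => ((-α * (Real.log ‖z n‖ / (c : ℝ) ^ n) : ℝ) : EReal)) atTop
      (𝓝 (0 : ℝ)) := EReal.tendsto_coe.2 (by simpa using hz.const_mul (-α))
  have hsum := (EReal.continuousAt_add (p := (g, ((0 : ℝ) : EReal)))
    (Or.inr (EReal.coe_ne_bot 0)) (Or.inr (EReal.coe_ne_top 0))).tendsto.comp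
    (hw.prodMk_nhds hz')
  simp only [EReal.coe_zero, add_zero] at hsum
  refine hsum.congr' ?_
  filter_upwards [hzne] with n hn
  simp only [Function.comp]
  rw [show ‖w n‖ₑ / ‖z n‖ₑ ^ α = ‖w n‖ₑ * ‖z n‖ₑ ^ (-α) by
      rw [div_eq_mul_inv, ENNReal.rpow_neg], ENNReal.log_mul_add, ENNReal.log_rpow,
    log_enorm_of_ne_zero hn, EReal.left_distrib_of_nonneg_of_ne_top
      (by exact_mod_cast (by positivity : (0 : ℝ) ≤ ((c : ℝ) ^ n)⁻¹)) (EReal.coe_ne_top _),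
    ← EReal.coe_mul, ← EReal.coe_mul]
  congr 2
  ring

/-- Under `|w (n + 1)| ≤ |w n| ^ d` the sequence `d⁻ⁿ log |w n|` is nonincreasing. -/
theorem exists_hasLogRate_of_norm_le_pow {d : ℕ} (hd : d ≠ 0) {w : ℕ → ℂ}
    (h : ∀ᶠ n in atTop, ‖w (n + 1)‖ ≤ ‖w n‖ ^ d) :
    ∃ g, HasLogRate d (fun n => ‖w n‖ₑ) g := by
  obtain ⟨N, hN⟩ := eventually_atTop.1 h
  set a : ℕ → EReal := fun n => ((((d : ℝ) ^ n)⁻¹ : ℝ) : EReal) * ENNReal.log ‖w n‖ₑ with ha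
  have hd0 : (d : ℝ) ≠ 0 := by exact_mod_cast hd
  have hanti : Antitone fun k => a (k + N) := by
    refine antitone_nat_of_succ_le fun k => ?_
    have h1 : ‖w (k + N + 1)‖ₑ ≤ ‖w (k + N)‖ₑ ^ d := by
      rw [← enorm_pow, enorm_le_iff_norm_le, norm_pow]
      exact hN _ (by omega)
    have h2 := ENNReal.log_monotone h1
    rw [ENNReal.log_pow] at h2
    have h3 := mul_le_mul_of_nonneg_left h2
      (show (0 : EReal) ≤ ((((d : ℝ) ^ (k + N + 1))⁻¹ : ℝ) : EReal) by
        exact_mod_cast (by positivity : (0 : ℝ) ≤ ((d : ℝ) ^ (k + N + 1))⁻¹))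
    rw [show k + 1 + N = k + N + 1 by omega]
    refine h3.trans (le_of_eq ?_)
    rw [← mul_assoc, show ((d : ℕ) : EReal) = (((d : ℝ)) : EReal) from rfl, ← EReal.coe_mul]
    congr 3
    rw [pow_succ]
    field_simp
  exact ⟨_, (tendsto_add_atTop_iff_nat N).1 (tendsto_atTop_iInf hanti)⟩

theorem tendsto_neg_log_norm_atTop {w : ℕ → ℂ} (h0 : Tendsto w atTop (𝓝 0))
    (hne : ∀ᶠ n in atTop, w n ≠ 0) : Tendsto (fun n => -Real.log ‖w n‖) atTop atTop := by
  refine tendsto_neg_atBot_atTop.comp (Real.tendsto_log_nhdsGT_zero.comp ?_)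
  exact tendsto_nhdsWithin_iff.2 ⟨tendsto_zero_iff_norm_tendsto_zero.1 h0,
    hne.mono fun n hn => norm_pos_iff.2 hn⟩

/-- A sequence converges to `0` faster than any `exp (-C * L ^ n)` if its `L`-th power law comes with
an extra factor that is itself exponentially small in `L ^ n`. -/
theorem hasLogRate_bot_of_norm_le {L : ℕ} (hL : 2 ≤ L) {c C : ℝ} (hc : 0 < c) (hC : 0 < C)
    {w : ℕ → ℂ} (hw0 : Tendsto w atTop (𝓝 0))
    (h : ∀ᶠ n in atTop,
      ‖w (n + 1)‖ ≤ C * (‖w n‖ ^ L * max (Real.exp (-(c * (L : ℝ) ^ n))) ‖w n‖)) :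
    HasLogRate L (fun n => ‖w n‖ₑ) ⊥ := by
  by_cases hne : ∀ᶠ n in atTop, w n ≠ 0
  · rw [hasLogRate_enorm_iff hne, EReal.tendsto_coe_nhds_bot_iff]
    have hlim : Tendsto (fun n => -Real.log ‖w n‖ / (L : ℝ) ^ n) atTop atTop := by
      refine tendsto_div_pow_atTop_of_min (ζ := fun n => c * (L : ℝ) ^ n) (C := Real.log C)
        (by exact_mod_cast hL) hc (tendsto_neg_log_norm_atTop hw0 hne)
        (Eventually.of_forall fun n => le_rfl) ?_
      filter_upwards [h, hne, (tendsto_add_atTop_nat 1).eventually hne] with n h1 h2 h3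
      have hw : 0 < ‖w n‖ := norm_pos_iff.2 h2
      have hm : 0 < max (Real.exp (-(c * (L : ℝ) ^ n))) ‖w n‖ := lt_max_of_lt_right hw
      have h4 := Real.log_le_log (norm_pos_iff.2 h3) h1
      rw [Real.log_mul hC.ne' (by positivity), Real.log_mul (by positivity) hm.ne',
        Real.log_pow] at h4
      have h5 : Real.log (max (Real.exp (-(c * (L : ℝ) ^ n))) ‖w n‖) ≤
          -min (-Real.log ‖w n‖) (c * (L : ℝ) ^ n) := by
        rcases max_choice (Real.exp (-(c * (L : ℝ) ^ n))) ‖w n‖ with h6 | h6 <;> rw [h6]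
        · rw [Real.log_exp]; exact neg_le_neg (min_le_right _ _)
        · linarith [min_le_left (-Real.log ‖w n‖) (c * (L : ℝ) ^ n)]
      linarith
    exact (tendsto_neg_atTop_atBot.comp hlim).congr fun n => by simp [neg_div]
  · refine HasLogRate.bot_of_eventually_zero (by omega) ?_
    obtain ⟨N, hN⟩ := eventually_atTop.1 h
    obtain ⟨N', hN', hw⟩ := (frequently_atTop.1 (not_eventually.1 hne)) N
    rw [not_not] at hw
    refine eventually_atTop.2 ⟨N', fun n hn => ?_⟩
    induction n, hn using Nat.le_induction with
    | base => simpa using hw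
    | succ n hn ih =>
      have := hN n (by omega)
      rw [enorm_eq_zero] at ih ⊢
      rw [ih, norm_zero, zero_pow (by omega), zero_mul, mul_zero] at this
      simpa using this

theorem hasLogRate_bot_of_norm_le_pow_succ {L : ℕ} (hL : 2 ≤ L) {C : ℝ} (hC : 0 < C)
    {w : ℕ → ℂ} (hw0 : Tendsto w atTop (𝓝 0))
    (h : ∀ᶠ n in atTop, ‖w (n + 1)‖ ≤ C * ‖w n‖ ^ (L + 1)) :
    HasLogRate L (fun n => ‖w n‖ₑ) ⊥ := by
  refine hasLogRate_bot_of_norm_le hL one_pos hC hw0 (h.mono fun n hn => hn.trans ?_)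
  rw [pow_succ]
  gcongr
  exact le_max_right _ _

/-! ### Estimates of the two components near the origin -/

theorem exists_norm_bounds_of_analyticOrderAt {p : ℂ → ℂ} (hp : AnalyticAt ℂ p 0) {δ : ℕ}
    (h : analyticOrderAt p 0 = (δ : ℕ∞)) :
    ∃ c₁ c₂ : ℝ, 0 < c₁ ∧ 0 < c₂ ∧
      ∀ᶠ z in 𝓝 (0 : ℂ), c₁ * ‖z‖ ^ δ ≤ ‖p z‖ ∧ ‖p z‖ ≤ c₂ * ‖z‖ ^ δ := by
  obtain ⟨g, hg, hg0, hpg⟩ := hp.analyticOrderAt_eq_natCast.1 h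
  have hpos : 0 < ‖g 0‖ := norm_pos_iff.2 hg0
  have hcont : Tendsto (fun z => ‖g z‖) (𝓝 0) (𝓝 ‖g 0‖) := hg.continuousAt.norm
  refine ⟨‖g 0‖ / 2, 2 * ‖g 0‖, by positivity, by positivity, ?_⟩
  filter_upwards [hpg, hcont.eventually_const_le (half_lt_self hpos),
    hcont.eventually_le_const (show ‖g 0‖ < 2 * ‖g 0‖ by linarith)] with z h1 h2 h3
  have hz : 0 ≤ ‖z‖ ^ δ := by positivity
  rw [h1, sub_zero, smul_eq_mul, norm_mul, norm_pow, mul_comm (‖z‖ ^ δ)]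
  exact ⟨mul_le_mul_of_nonneg_right h2 hz, mul_le_mul_of_nonneg_right h3 hz⟩

theorem eventually_norm_le_half_and_ne_zero {p : ℂ → ℂ} {δ : ℕ} {c₁ c₂ : ℝ} (hδ : 2 ≤ δ)
    (hc₁ : 0 < c₁)
    (hp : ∀ᶠ z in 𝓝 (0 : ℂ), c₁ * ‖z‖ ^ δ ≤ ‖p z‖ ∧ ‖p z‖ ≤ c₂ * ‖z‖ ^ δ) :
    ∀ᶠ z in 𝓝 (0 : ℂ), ‖p z‖ ≤ 1 / 2 * ‖z‖ ∧ (z ≠ 0 → p z ≠ 0) := by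
  have hlim : Tendsto (fun z : ℂ => c₂ * ‖z‖ ^ (δ - 1)) (𝓝 0) (𝓝 0) := by
    have : Continuous fun z : ℂ => c₂ * ‖z‖ ^ (δ - 1) := by fun_prop
    simpa [zero_pow (show δ - 1 ≠ 0 by omega)] using this.tendsto 0
  filter_upwards [hp, hlim.eventually_le_const (by norm_num : (0 : ℝ) < 1 / 2)] with z h1 h2
  constructor
  · calc ‖p z‖ ≤ c₂ * ‖z‖ ^ δ := h1.2
      _ = c₂ * ‖z‖ ^ (δ - 1) * ‖z‖ := by
          rw [mul_assoc, ← pow_succ, Nat.sub_add_cancel (by omega)]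
      _ ≤ 1 / 2 * ‖z‖ := by gcongr
  · intro hz
    have : 0 < ‖z‖ := norm_pos_iff.2 hz
    exact norm_pos_iff.1 (lt_of_lt_of_le (by positivity) h1.1)

namespace IsPowerSeriesCoeff

variable {q : ℂ × ℂ → ℂ} {b : ℕ → ℕ → ℂ}

/-- Cauchy-type estimate: near the origin `q` is bounded by the largest of its rescaled monomials. -/
theorem exists_norm_le (hb : IsPowerSeriesCoeff q b) :
    ∃ ρ M : ℝ, 0 < ρ ∧ 0 < M ∧ ∀ z w : ℂ, ∀ K : ℝ, ‖z‖ ≤ ρ → ‖w‖ ≤ ρ → 0 ≤ K →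
      (∀ i j, b i j ≠ 0 → (‖z‖ / ρ) ^ i * (‖w‖ / ρ) ^ j ≤ K) → ‖q (z, w)‖ ≤ M * K := by
  obtain ⟨ε, hε, hball⟩ := Metric.eventually_nhds_iff.1 hb
  have hρ : 0 < ε / 2 := half_pos hε
  have hρn : ‖((ε / 2 : ℝ) : ℂ)‖ = ε / 2 := by
    rw [Complex.norm_real, Real.norm_of_nonneg hρ.le]
  have hsmall : ∀ z w : ℂ, ‖z‖ ≤ ε / 2 → ‖w‖ ≤ ε / 2 → dist (z, w) (0 : ℂ × ℂ) < ε := by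
    intro z w hz hw
    rw [dist_zero_right, Prod.norm_def]
    exact lt_of_le_of_lt (max_le hz hw) (half_lt_self hε)
  have hsum := (hball (hsmall ((ε / 2 : ℝ) : ℂ) ((ε / 2 : ℝ) : ℂ) hρn.le hρn.le)).summable.norm
  simp only [norm_mul, norm_pow, hρn] at hsum
  set B : ℕ × ℕ → ℝ := fun ij => ‖b ij.1 ij.2‖ * (ε / 2) ^ ij.1 * (ε / 2) ^ ij.2 with hB
  have hB0 : ∀ ij, 0 ≤ B ij := fun ij => by positivity
  refine ⟨ε / 2, (∑' ij, B ij) + 1, hρ, 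
    add_pos_of_nonneg_of_pos (tsum_nonneg hB0) one_pos, ?_⟩
  intro z w K hz hw hK h
  rw [← (hball (hsmall z w hz hw)).tsum_eq]
  refine (tsum_of_norm_bounded (hsum.hasSum.mul_right K) fun ij => ?_).trans
    (mul_le_mul_of_nonneg_right (by linarith) hK)
  rcases eq_or_ne (b ij.1 ij.2) 0 with h0 | h0
  · simpa only [h0, zero_mul, norm_zero] using mul_nonneg (hB0 ij) hK
  · have h1 := mul_le_mul_of_nonneg_left (h _ _ h0) (hB0 ij)
    refine le_trans (le_of_eq ?_) h1
    simp only [norm_mul, norm_pow, hB, div_pow]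
    field_simp

theorem sub_monomial (hb : IsPowerSeriesCoeff q b) (i₀ j₀ : ℕ) :
    IsPowerSeriesCoeff (fun x => q x - b i₀ j₀ * x.1 ^ i₀ * x.2 ^ j₀)
      (fun i j => if i = i₀ ∧ j = j₀ then 0 else b i j) := by
  filter_upwards [hb] with x hx
  have h1 : HasSum (fun ij : ℕ × ℕ => if ij = (i₀, j₀) then b i₀ j₀ * x.1 ^ i₀ * x.2 ^ j₀ else 0)
      (b i₀ j₀ * x.1 ^ i₀ * x.2 ^ j₀) := hasSum_ite_eq _ _
  refine Eq.subst (motive := fun F => HasSum F _) (funext ?_) (hx.sub h1)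
  rintro ⟨i, j⟩
  by_cases h : i = i₀ ∧ j = j₀
  · obtain ⟨rfl, rfl⟩ := h; simp
  · have h' : (i, j) ≠ (i₀, j₀) := fun e => h (by simpa using e)
    simp [h, h']

theorem exists_norm_le_pow_mul_max (hb : IsPowerSeriesCoeff q b) {γ d : ℕ} (hγ : 0 < γ)
    (hlow : ∀ i j, b i j ≠ 0 → d ≤ j ∧ (j = d → γ ≤ i)) :
    ∃ C : ℝ, 0 < C ∧ ∀ᶠ x in 𝓝 (0 : ℂ × ℂ), ‖q x‖ ≤ C * (‖x.2‖ ^ d * max ‖x.1‖ ‖x.2‖) := by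
  obtain ⟨ρ, M, hρ, hM, h⟩ := hb.exists_norm_le
  refine ⟨M / ρ ^ (d + 1), by positivity, ?_⟩
  filter_upwards [Metric.closedBall_mem_nhds (0 : ℂ × ℂ) hρ] with x hx
  rw [mem_closedBall_zero_iff, Prod.norm_def, max_le_iff] at hx
  have hZ1 : ‖x.1‖ / ρ ≤ 1 := (div_le_one hρ).2 hx.1
  have hW1 : ‖x.2‖ / ρ ≤ 1 := (div_le_one hρ).2 hx.2
  have hmax : max (‖x.1‖ / ρ) (‖x.2‖ / ρ) = max ‖x.1‖ ‖x.2‖ / ρ :=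
    max_div_div_right hρ.le _ _
  refine (h x.1 x.2 ((‖x.2‖ / ρ) ^ d * max (‖x.1‖ / ρ) (‖x.2‖ / ρ)) hx.1 hx.2
    (by positivity) ?_).trans (le_of_eq ?_)
  · intro i j hij
    obtain ⟨h1, h2⟩ := hlow i j hij
    set Z := ‖x.1‖ / ρ
    set W := ‖x.2‖ / ρ
    have hZ0 : 0 ≤ Z := by positivity
    have hW0 : 0 ≤ W := by positivity
    rcases h1.eq_or_lt with h3 | h3
    · rw [← h3, mul_comm]
      gcongr
      calc Z ^ i ≤ Z ^ 1 := pow_le_pow_of_le_one hZ0 hZ1 (hγ.trans_le (h2 h3.symm))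
        _ = Z := pow_one Z
        _ ≤ _ := le_max_left _ _
    · calc Z ^ i * W ^ j ≤ 1 * W ^ (d + 1) := by
            exact mul_le_mul (pow_le_one₀ hZ0 hZ1) (pow_le_pow_of_le_one hW0 hW1 h3)
              (by positivity) zero_le_one
        _ = W ^ d * W := by rw [one_mul, pow_succ]
        _ ≤ _ := by gcongr; exact le_max_right _ _
  · rw [hmax, div_pow, pow_succ]
    field_simp

theorem exists_norm_le_pow_on_fiber (hb : IsPowerSeriesCoeff q b) {J : ℕ}
    (hJ : ∀ j, b 0 j ≠ 0 → J ≤ j) :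
    ∃ C : ℝ, 0 < C ∧ ∀ᶠ w in 𝓝 (0 : ℂ), ‖q (0, w)‖ ≤ C * ‖w‖ ^ J := by
  obtain ⟨ρ, M, hρ, hM, h⟩ := hb.exists_norm_le
  refine ⟨M / ρ ^ J, by positivity, ?_⟩
  filter_upwards [Metric.closedBall_mem_nhds (0 : ℂ) hρ] with w hw
  rw [mem_closedBall_zero_iff] at hw
  refine (h 0 w ((‖w‖ / ρ) ^ J) (by simpa using hρ.le) hw (by positivity) ?_).trans
    (le_of_eq ?_)
  · intro i j hij
    rcases Nat.eq_zero_or_pos i with rfl | hi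
    · rw [pow_zero, one_mul]
      exact pow_le_pow_of_le_one (by positivity) ((div_le_one hρ).2 hw) (hJ j hij)
    · rw [norm_zero, zero_div, zero_pow hi.ne', zero_mul]
      positivity
  · rw [div_pow]; field_simp

theorem eventually_eq_zero_of_coeff_eq_zero (hb : IsPowerSeriesCoeff q b) (hb0 : ∀ i, b i 0 = 0) :
    ∀ᶠ z in 𝓝 (0 : ℂ), q (z, 0) = 0 := by
  have hcont : Tendsto (fun z : ℂ => (z, (0 : ℂ))) (𝓝 0) (𝓝 (0 : ℂ × ℂ)) := by
    have : Continuous fun z : ℂ => (z, (0 : ℂ)) := by fun_prop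
    exact this.tendsto 0
  filter_upwards [hcont.eventually hb] with z hz
  refine hz.unique ?_
  convert (hasSum_zero : HasSum (fun _ : ℕ × ℕ => (0 : ℂ)) 0) using 2 with ij
  obtain ⟨i, j⟩ := ij
  rcases Nat.eq_zero_or_pos j with rfl | hj
  · simp [hb0]
  · simp [hj.ne']

/-- In a thin wedge below the last edge the monomial of the last vertex dominates all the others. -/
theorem exists_norm_sub_monomial_le (hb : IsPowerSeriesCoeff q b) {γ d : ℕ} {l : ℝ} (hl : 0 < l)
    (hγd : b γ d ≠ 0) (hlow : ∀ i j, b i j ≠ 0 → d ≤ j ∧ (j = d → γ ≤ i))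
    (hedge : ∀ i j, b i j ≠ 0 → (γ : ℝ) + l * d ≤ i + l * j) :
    ∃ r₀ : ℝ, 0 < r₀ ∧ ∀ z w : ℂ, z ≠ 0 → ‖z‖ < r₀ → ‖w‖ ≤ r₀ * ‖z‖ ^ l →
      ‖q (z, w) - b γ d * z ^ γ * w ^ d‖ ≤ ‖b γ d‖ / 2 * (‖z‖ ^ γ * ‖w‖ ^ d) := by
  obtain ⟨ρ, M, hρ, hM, h⟩ := (hb.sub_monomial γ d).exists_norm_le
  have hβ : 0 < ‖b γ d‖ := norm_pos_iff.2 hγd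
  set κ := min 1 (‖b γ d‖ / 2 * ρ ^ (γ + d) / M) with hκ
  have hκ0 : 0 < κ := lt_min one_pos (by positivity)
  have hκ1 : κ ≤ 1 := min_le_left _ _
  have hρl : 0 < ρ ^ l := Real.rpow_pos_of_pos hρ l
  refine ⟨min (κ * ρ) (κ * ρ / ρ ^ l), lt_min (by positivity) (by positivity), ?_⟩
  intro z w hz0 hz hw
  have hzpos : 0 < ‖z‖ := norm_pos_iff.2 hz0
  have hzκ : ‖z‖ / ρ ≤ κ := by
    rw [div_le_iff₀ hρ]; exact hz.le.trans (min_le_left _ _)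
  have hWZ : ‖w‖ / ρ ≤ κ * (‖z‖ / ρ) ^ l := by
    rw [div_le_iff₀ hρ, Real.div_rpow hzpos.le hρ.le]
    calc ‖w‖ ≤ κ * ρ / ρ ^ l * ‖z‖ ^ l :=
          hw.trans (mul_le_mul_of_nonneg_right (min_le_right _ _) (by positivity))
      _ = _ := by field_simp
  set Z := ‖z‖ / ρ with hZ
  set W := ‖w‖ / ρ with hW
  have hZ0 : 0 < Z := by positivity
  have hZ1 : Z ≤ 1 := hzκ.trans hκ1
  have hW0 : 0 ≤ W := by positivity
  have hW1 : W ≤ 1 := hWZ.trans (mul_le_one₀ hκ1 (by positivity)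
    (Real.rpow_le_one hZ0.le hZ1 hl.le))
  have hkey := h z w (Z ^ γ * W ^ d * κ) ((div_le_one hρ).1 hZ1) ((div_le_one hρ).1 hW1)
    (by positivity) ?_
  · refine hkey.trans ?_
    have h1 : κ ≤ ‖b γ d‖ / 2 * ρ ^ (γ + d) / M := min_le_right _ _
    calc M * (Z ^ γ * W ^ d * κ)
        ≤ M * (Z ^ γ * W ^ d * (‖b γ d‖ / 2 * ρ ^ (γ + d) / M)) := by gcongr
      _ = _ := by rw [hZ, hW, div_pow, div_pow, pow_add]; field_simp
  · intro i j hij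
    have hne : ¬ (i = γ ∧ j = d) := fun e => hij (if_pos e)
    have hij' : b i j ≠ 0 := by rwa [if_neg hne] at hij
    obtain ⟨h1, h2⟩ := hlow i j hij'
    rcases h1.eq_or_lt with h3 | h3
    · have h4 : γ + 1 ≤ i := lt_of_le_of_ne (h2 h3.symm) fun e => hne ⟨e.symm, h3.symm⟩
      rw [← h3]
      calc Z ^ i * W ^ d ≤ Z ^ (γ + 1) * W ^ d := by
            exact mul_le_mul_of_nonneg_right (pow_le_pow_of_le_one hZ0.le hZ1 h4) (by positivity)
        _ = Z ^ γ * W ^ d * Z := by ring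
        _ ≤ _ := by gcongr
    · obtain ⟨k, rfl⟩ := Nat.exists_eq_add_of_le h1
      have hk : k ≠ 0 := by omega
      have h4 : (γ : ℝ) ≤ i + l * k := by
        have := hedge i _ hij'
        push_cast at this
        linarith
      -- the excess powers of `w` are traded for powers of `z`
      have h5 : Z ^ i * (Z ^ l) ^ k ≤ Z ^ γ := by
        rw [← Real.rpow_natCast (Z ^ l) k, ← Real.rpow_mul hZ0.le, ← Real.rpow_natCast Z i,
          ← Real.rpow_add hZ0, ← Real.rpow_natCast Z γ]
        exact Real.rpow_le_rpow_of_exponent_ge hZ0 hZ1 h4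
      have h6 : κ ^ k ≤ κ := by
        simpa using pow_le_pow_of_le_one hκ0.le hκ1 (Nat.one_le_iff_ne_zero.2 hk)
      calc Z ^ i * W ^ (d + k) = Z ^ i * W ^ d * W ^ k := by rw [pow_add]; ring
        _ ≤ Z ^ i * W ^ d * (κ * Z ^ l) ^ k := by gcongr
        _ = (Z ^ i * (Z ^ l) ^ k) * W ^ d * κ ^ k := by rw [mul_pow]; ring
        _ ≤ Z ^ γ * W ^ d * κ := by gcongr

theorem exists_norm_bounds_in_wedge (hb : IsPowerSeriesCoeff q b) {γ d : ℕ} {l : ℝ} (hl : 0 < l)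
    (hγd : b γ d ≠ 0) (hlow : ∀ i j, b i j ≠ 0 → d ≤ j ∧ (j = d → γ ≤ i))
    (hedge : ∀ i j, b i j ≠ 0 → (γ : ℝ) + l * d ≤ i + l * j) :
    ∃ r₀ k₁ k₂ : ℝ, 0 < r₀ ∧ 0 < k₁ ∧ 0 < k₂ ∧
      ∀ z w : ℂ, z ≠ 0 → ‖z‖ < r₀ → ‖w‖ ≤ r₀ * ‖z‖ ^ l →
        k₁ * (‖z‖ ^ γ * ‖w‖ ^ d) ≤ ‖q (z, w)‖ ∧ ‖q (z, w)‖ ≤ k₂ * (‖z‖ ^ γ * ‖w‖ ^ d) := by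
  obtain ⟨r₀, hr₀, h⟩ := hb.exists_norm_sub_monomial_le hl hγd hlow hedge
  have hβ : 0 < ‖b γ d‖ := norm_pos_iff.2 hγd
  refine ⟨r₀, ‖b γ d‖ / 2, 2 * ‖b γ d‖, hr₀, by positivity, by positivity, ?_⟩
  intro z w hz0 hz hw
  have h1 := h z w hz0 hz hw
  have h2 : ‖b γ d * z ^ γ * w ^ d‖ = ‖b γ d‖ * (‖z‖ ^ γ * ‖w‖ ^ d) := by
    rw [norm_mul, norm_mul, norm_pow, norm_pow, mul_assoc]
  have h3 : 0 ≤ ‖b γ d‖ * (‖z‖ ^ γ * ‖w‖ ^ d) := by positivity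
  have h4 := norm_sub_norm_le (q (z, w)) (b γ d * z ^ γ * w ^ d)
  have h5 := norm_sub_norm_le (b γ d * z ^ γ * w ^ d) (q (z, w))
  rw [norm_sub_rev] at h5
  constructor <;> linarith

/-- Outside the wedge, `ω = -log |w|` is at most `l * ζ + C₀` with `ζ = -log |z|`, so a power of `z`
can be traded for a power of `w`. With the dichotomy of the support this bounds every monomial
of `q`, hence `q`. -/
theorem exists_neg_log_norm_ge_of_not_mem_wedge (hb : IsPowerSeriesCoeff q b)
    {L l α ε : ℝ} {n' m' : ℕ} (hl : 0 < l) (hL : 0 < L) (hε : 0 < ε)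
    (hn' : (n' : ℝ) = α * (L - m'))
    (hsupp : ∀ i j, b i j ≠ 0 → (n' ≤ i ∧ (n' : ℝ) + l * m' ≤ i + l * j) ∨
      (i ≤ n' ∧ l * (L + ε) ≤ i + l * j)) (C₀ : ℝ) :
    ∃ C₁ : ℝ, ∀ᶠ x in 𝓝 (0 : ℂ × ℂ), x.1 ≠ 0 → x.2 ≠ 0 → q x ≠ 0 →
      -Real.log ‖x.2‖ ≤ l * -Real.log ‖x.1‖ + C₀ →
      min (m' * -Real.log ‖x.2‖ + α * (L - m') * -Real.log ‖x.1‖)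
        ((L + ε) * -Real.log ‖x.2‖) - C₁ ≤ -Real.log ‖q x‖ := by
  obtain ⟨ρ, M, hρ, hM, h⟩ := hb.exists_norm_le
  -- `C₂` is the constant `C₀` in the coordinates rescaled by `ρ`
  set C₂ := |C₀ + Real.log ρ - l * Real.log ρ| with hC₂
  have hC₂0 : 0 ≤ C₂ := abs_nonneg _
  set C₃ := (m' : ℝ) * C₂ + n' * C₂ / l with hC₃
  refine ⟨C₃ + Real.log M + (m' + n' + (L + ε)) * |Real.log ρ|, ?_⟩
  filter_upwards [Metric.closedBall_mem_nhds (0 : ℂ × ℂ) hρ] with x hx hz hw hq hout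
  rw [mem_closedBall_zero_iff, Prod.norm_def, max_le_iff] at hx
  have hzpos : 0 < ‖x.1‖ := norm_pos_iff.2 hz
  have hwpos : 0 < ‖x.2‖ := norm_pos_iff.2 hw
  set ζ := -Real.log (‖x.1‖ / ρ) with hζ
  set ω := -Real.log (‖x.2‖ / ρ) with hω
  have hζe : ζ = -Real.log ‖x.1‖ + Real.log ρ := by
    rw [hζ, Real.log_div hzpos.ne' hρ.ne']; ring
  have hωe : ω = -Real.log ‖x.2‖ + Real.log ρ := by
    rw [hω, Real.log_div hwpos.ne' hρ.ne']; ring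
  have hζ0 : 0 ≤ ζ := neg_nonneg.2 (Real.log_nonpos (by positivity) ((div_le_one hρ).2 hx.1))
  have hω0 : 0 ≤ ω := neg_nonneg.2 (Real.log_nonpos (by positivity) ((div_le_one hρ).2 hx.2))
  have hout' : ω ≤ l * ζ + C₂ := by
    rw [hζe, hωe]
    have := le_abs_self (C₀ + Real.log ρ - l * Real.log ρ)
    rw [← hC₂] at this
    linarith
  set μ := min (m' * ω + n' * ζ) ((L + ε) * ω) - C₃ with hμ
  have hbound : ∀ i j, b i j ≠ 0 → μ ≤ i * ζ + j * ω := by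
    intro i j hij
    have hC₃1 : (m' : ℝ) * C₂ ≤ C₃ := le_add_of_nonneg_right (by positivity)
    have hC₃2 : (n' : ℝ) * C₂ / l ≤ C₃ := le_add_of_nonneg_left (by positivity)
    have hC₃0 : 0 ≤ C₃ := by positivity
    rcases hsupp i j hij with ⟨h1, h2⟩ | ⟨h1, h2⟩
    · have h1R : (n' : ℝ) ≤ i := by exact_mod_cast h1
      have h3 : μ ≤ m' * ω + n' * ζ - C₃ := sub_le_sub_right (min_le_left _ _) _
      rcases le_total m' j with h4 | h4
      · have h4R : (m' : ℝ) ≤ j := by exact_mod_cast h4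
        have := mul_le_mul_of_nonneg_right h1R hζ0
        have := mul_le_mul_of_nonneg_right h4R hω0
        linarith
      · have h4R : (j : ℝ) ≤ m' := by exact_mod_cast h4
        have h5 : l * (m' - j) * ζ ≤ (i - n') * ζ :=
          mul_le_mul_of_nonneg_right (by linarith) hζ0
        have h6 : ((m' : ℝ) - j) * (ω - C₂) ≤ (m' - j) * (l * ζ) :=
          mul_le_mul_of_nonneg_left (by linarith) (by linarith)
        have h7 : ((m' : ℝ) - j) * C₂ ≤ m' * C₂ :=
          mul_le_mul_of_nonneg_right (by linarith [(Nat.cast_nonneg j : (0 : ℝ) ≤ j)]) hC₂0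
        linarith
    · have h1R : (i : ℝ) ≤ n' := by exact_mod_cast h1
      have h3 : μ ≤ (L + ε) * ω - C₃ := sub_le_sub_right (min_le_right _ _) _
      have h4 : (i : ℝ) * (ω - C₂) ≤ i * (l * ζ) :=
        mul_le_mul_of_nonneg_left (by linarith) i.cast_nonneg
      have h5 : l * (L + ε) * ω ≤ (i + l * j) * ω := mul_le_mul_of_nonneg_right h2 hω0
      have h6 : (i : ℝ) * C₂ ≤ n' * C₂ := mul_le_mul_of_nonneg_right h1R hC₂0
      have h7 : (n' : ℝ) * C₂ ≤ l * C₃ := by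
        rw [div_le_iff₀ hl] at hC₃2; linarith
      have h8 : l * ((L + ε) * ω - C₃) ≤ l * (i * ζ + j * ω) := by linarith
      exact h3.trans (le_of_mul_le_mul_left h8 hl)
  have hle : ‖q x‖ ≤ M * Real.exp (-μ) := by
    refine h x.1 x.2 (Real.exp (-μ)) hx.1 hx.2 (Real.exp_pos _).le fun i j hij => ?_
    rw [← Real.exp_log (show 0 < ‖x.1‖ / ρ by positivity),
      ← Real.exp_log (show 0 < ‖x.2‖ / ρ by positivity), ← Real.exp_nat_mul, ← Real.exp_nat_mul,
      ← Real.exp_add, Real.exp_le_exp]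
    have := hbound i j hij
    rw [hζ, hω] at this
    linarith
  have hlog : Real.log ‖q x‖ ≤ Real.log M - μ := by
    have := Real.log_le_log (norm_pos_iff.2 hq) hle
    rwa [Real.log_mul hM.ne' (Real.exp_pos _).ne', Real.log_exp, ← sub_eq_add_neg] at this
  -- return to the original coordinates
  have hρ1 := neg_abs_le (Real.log ρ)
  have hmin : min (m' * -Real.log ‖x.2‖ + α * (L - m') * -Real.log ‖x.1‖)
      ((L + ε) * -Real.log ‖x.2‖) - (m' + n' + (L + ε)) * |Real.log ρ| ≤
      min (m' * ω + n' * ζ) ((L + ε) * ω) := by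
    rw [← hn', hζe, hωe]
    have e1 : (0 : ℝ) ≤ m' * |Real.log ρ| := by positivity
    have e2 : (0 : ℝ) ≤ n' * |Real.log ρ| := by positivity
    have e3 : (0 : ℝ) ≤ (L + ε) * |Real.log ρ| := by positivity
    have e4 := mul_le_mul_of_nonneg_left hρ1 (Nat.cast_nonneg (α := ℝ) m')
    have e5 := mul_le_mul_of_nonneg_left hρ1 (Nat.cast_nonneg (α := ℝ) n')
    have e6 := mul_le_mul_of_nonneg_left hρ1 (show 0 ≤ L + ε by linarith)
    refine le_min ?_ ?_
    · have := min_le_left (m' * -Real.log ‖x.2‖ + n' * -Real.log ‖x.1‖)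
        ((L + ε) * -Real.log ‖x.2‖)
      linarith
    · have := min_le_right (m' * -Real.log ‖x.2‖ + n' * -Real.log ‖x.1‖)
        ((L + ε) * -Real.log ‖x.2‖)
      linarith
  linarith

end IsPowerSeriesCoeff

/-! ### Forward invariance of the wedge -/

/-- One step of the forward invariance of the wedge. The exponent `γ + l * d - l * δ` has the sign of
the difference between the intercept of the last edge and `δ`. -/
theorem wedge_step {p : ℂ → ℂ} {q : ℂ × ℂ → ℂ} {δ γ d : ℕ} {l c₁ k₂ r : ℝ} (hl : 0 < l)
    (hc₁ : 0 < c₁) (hk₂ : 0 < k₂) (hr : 0 < r) {z w : ℂ} (hz : z ≠ 0)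
    (hp : c₁ * ‖z‖ ^ δ ≤ ‖p z‖) (hq : ‖q (z, w)‖ ≤ k₂ * (‖z‖ ^ γ * ‖w‖ ^ d))
    (hw : ‖w‖ < r * ‖z‖ ^ l)
    (hlt : k₂ * r ^ d * ‖z‖ ^ ((γ : ℝ) + l * d - l * δ) < r * c₁ ^ l) :
    ‖q (z, w)‖ < r * ‖p z‖ ^ l := by
  have hz' : 0 < ‖z‖ := norm_pos_iff.2 hz
  have hpow : ‖z‖ ^ γ * (‖z‖ ^ l) ^ d =
      ‖z‖ ^ ((γ : ℝ) + l * d - l * δ) * (‖z‖ ^ δ) ^ l := by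
    rw [← Real.rpow_natCast _ d, ← Real.rpow_mul hz'.le, ← Real.rpow_natCast _ γ,
      ← Real.rpow_natCast _ δ, ← Real.rpow_mul hz'.le, ← Real.rpow_add hz', ← Real.rpow_add hz']
    congr 1
    ring
  calc ‖q (z, w)‖ ≤ k₂ * (‖z‖ ^ γ * ‖w‖ ^ d) := hq
    _ ≤ k₂ * (‖z‖ ^ γ * (r * ‖z‖ ^ l) ^ d) := by gcongr
    _ = k₂ * r ^ d * ‖z‖ ^ ((γ : ℝ) + l * d - l * δ) * (‖z‖ ^ δ) ^ l := by
        rw [mul_pow, mul_assoc, ← hpow]; ring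
    _ < r * c₁ ^ l * (‖z‖ ^ δ) ^ l := by gcongr
    _ = r * (c₁ * ‖z‖ ^ δ) ^ l := by rw [Real.mul_rpow hc₁.le (by positivity)]; ring
    _ ≤ r * ‖p z‖ ^ l := by gcongr

theorem exists_wedge_forward_invariant {p : ℂ → ℂ} {q : ℂ × ℂ → ℂ} {δ γ d : ℕ}
    {l c₁ c₂ k₁ k₂ r₀ r : ℝ} (hl : 0 < l) (hc₁ : 0 < c₁) (hk₂ : 0 < k₂) (hr : 0 < r)
    (hrr₀ : r ≤ r₀)
    (hp : ∀ᶠ z in 𝓝 (0 : ℂ), c₁ * ‖z‖ ^ δ ≤ ‖p z‖ ∧ ‖p z‖ ≤ c₂ * ‖z‖ ^ δ)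
    (hq : ∀ z w : ℂ, z ≠ 0 → ‖z‖ < r₀ → ‖w‖ ≤ r₀ * ‖z‖ ^ l →
      k₁ * (‖z‖ ^ γ * ‖w‖ ^ d) ≤ ‖q (z, w)‖ ∧ ‖q (z, w)‖ ≤ k₂ * (‖z‖ ^ γ * ‖w‖ ^ d))
    (hlt : l * δ < γ + l * d) :
    ∃ η : ℝ, 0 < η ∧ ∀ z w : ℂ, z ≠ 0 → ‖z‖ < η → ‖w‖ < r * ‖z‖ ^ l →
      ‖q (z, w)‖ < r * ‖p z‖ ^ l := by
  have hσ : 0 < (γ : ℝ) + l * d - l * δ := sub_pos.2 hlt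
  have hlim : Tendsto (fun z : ℂ => k₂ * r ^ d * ‖z‖ ^ ((γ : ℝ) + l * d - l * δ)) (𝓝 0)
      (𝓝 0) := by
    have : Continuous fun z : ℂ => k₂ * r ^ d * ‖z‖ ^ ((γ : ℝ) + l * d - l * δ) :=
      continuous_const.mul (continuous_norm.rpow_const fun _ => Or.inr hσ.le)
    simpa [Real.zero_rpow hσ.ne'] using this.tendsto 0
  obtain ⟨η, hη, hball⟩ := Metric.eventually_nhds_iff.1 (hp.and
    (hlim.eventually_lt_const (show 0 < r * c₁ ^ l by positivity)))
  refine ⟨min η r₀, lt_min hη (hr.trans_le hrr₀), fun z w hz0 hz hw => ?_⟩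
  obtain ⟨h1, h2⟩ := hball (show dist z 0 < η by
    rw [dist_zero_right]; exact hz.trans_le (min_le_left _ _))
  exact wedge_step hl hc₁ hk₂ hr hz0 h1.1 (hq z w hz0 (hz.trans_le (min_le_right _ _))
    (hw.le.trans (by gcongr))).2 hw h2

/-- When the exponents balance, invariance comes from the width: the width `r` is replaced by
a multiple of `r ^ d` with `d ≥ 2`. -/
theorem exists_wedge_forward_invariant_of_eq {p : ℂ → ℂ} {q : ℂ × ℂ → ℂ} {δ γ d : ℕ}
    {l c₁ c₂ k₁ k₂ r₀ : ℝ} (hl : 0 < l) (hc₁ : 0 < c₁) (hk₂ : 0 < k₂) (hr₀ : 0 < r₀)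
    (hp : ∀ᶠ z in 𝓝 (0 : ℂ), c₁ * ‖z‖ ^ δ ≤ ‖p z‖ ∧ ‖p z‖ ≤ c₂ * ‖z‖ ^ δ)
    (hq : ∀ z w : ℂ, z ≠ 0 → ‖z‖ < r₀ → ‖w‖ ≤ r₀ * ‖z‖ ^ l →
      k₁ * (‖z‖ ^ γ * ‖w‖ ^ d) ≤ ‖q (z, w)‖ ∧ ‖q (z, w)‖ ≤ k₂ * (‖z‖ ^ γ * ‖w‖ ^ d))
    (heq : l * δ = γ + l * d) (hd : 2 ≤ d) :
    ∃ r₁ : ℝ, 0 < r₁ ∧ r₁ ≤ r₀ ∧ ∀ r, 0 < r → r < r₁ → ∀ z w : ℂ, z ≠ 0 → ‖z‖ < r₁ →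
      ‖w‖ < r * ‖z‖ ^ l → ‖q (z, w)‖ < r * ‖p z‖ ^ l := by
  obtain ⟨η, hη, hball⟩ := Metric.eventually_nhds_iff.1 hp
  have hcl : 0 < c₁ ^ l := Real.rpow_pos_of_pos hc₁ l
  refine ⟨min (min η r₀) (min 1 (c₁ ^ l / k₂)),
    lt_min (lt_min hη hr₀) (lt_min one_pos (by positivity)),
    (min_le_left _ _).trans (min_le_right _ _), ?_⟩
  intro r hr hrr₁ z w hz0 hz hw
  simp only [lt_min_iff] at hrr₁ hz
  obtain ⟨⟨-, hrr₀⟩, hr1, hrk⟩ := hrr₁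
  refine wedge_step hl hc₁ hk₂ hr hz0 (hball (by rw [dist_zero_right]; exact hz.1.1)).1
    (hq z w hz0 hz.1.2 (hw.le.trans (by gcongr))).2 hw ?_
  rw [show (γ : ℝ) + l * d - l * δ = 0 by linarith, Real.rpow_zero, mul_one]
  have hpow : r ^ d ≤ r ^ 2 := pow_le_pow_of_le_one hr.le hr1.le hd
  rw [lt_div_iff₀ hk₂] at hrk
  calc k₂ * r ^ d ≤ k₂ * r ^ 2 := by gcongr
    _ = r * (r * k₂) := by ring
    _ < r * c₁ ^ l := by gcongr

/-- An orbit that enters an invariant wedge stays there and its base point tends to `0`. -/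
theorem forward_orbit_mem_wedge {p : ℂ → ℂ} {q : ℂ × ℂ → ℂ} {l r r₁ : ℝ} (hr : 0 < r)
    (hrr₁ : r < r₁) (hl : l ≠ 0)
    (hp : ∀ z, ‖z‖ < r₁ → ‖p z‖ ≤ 1 / 2 * ‖z‖ ∧ (z ≠ 0 → p z ≠ 0))
    (hinv : ∀ z w : ℂ, z ≠ 0 → ‖z‖ < r₁ → ‖w‖ < r * ‖z‖ ^ l → ‖q (z, w)‖ < r * ‖p z‖ ^ l)
    {z w : ℕ → ℂ} (hz : ∀ n, z (n + 1) = p (z n)) (hw : ∀ n, w (n + 1) = q (z n, w n))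
    {N : ℕ} (hN : (z N, w N) ∈ wedge l r) :
    (∀ n, N ≤ n → z n ≠ 0 ∧ (z n, w n) ∈ wedge l r) ∧ Tendsto z atTop (𝓝 0) := by
  have hmem : ∀ n, N ≤ n → z n ≠ 0 ∧ (z n, w n) ∈ wedge l r := by
    intro n hn
    induction n, hn using Nat.le_induction with
    | base =>
      refine ⟨fun h => ?_, hN⟩
      have := hN.2
      rw [h, norm_zero, Real.zero_rpow hl, mul_zero] at this
      exact absurd this (not_lt.2 (norm_nonneg _))
    | succ n hn ih =>
      obtain ⟨h0, h1, h2⟩ := ih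
      simp only at h1 h2
      have hlt := h1.trans hrr₁
      rw [hz, hw]
      refine ⟨(hp _ hlt).2 h0, ?_, hinv _ _ h0 hlt h2⟩
      have := (hp _ hlt).1
      simp only
      linarith [norm_nonneg (z n)]
  refine ⟨hmem, ?_⟩
  rw [← tendsto_add_atTop_iff_nat N, tendsto_zero_iff_norm_tendsto_zero]
  refine squeeze_zero (fun k => norm_nonneg _) (g := fun k => (1 / 2 : ℝ) ^ k * ‖z N‖) ?_ ?_
  · intro k
    induction k with
    | zero => simp
    | succ k ih =>
      have h1 := (hp _ ((hmem (k + N) (by omega)).2.1.trans hrr₁)).1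
      simp only at h1
      rw [show k + 1 + N = k + N + 1 by omega, hz, pow_succ]
      linarith
  · simpa using (tendsto_pow_atTop_nhds_zero_of_lt_one (by norm_num : (0 : ℝ) ≤ 1 / 2)
      (by norm_num)).mul_const ‖z N‖

/-! ### Orbits of the base -/

theorem abs_neg_log_sub_le {x y c₁ c₂ e : ℝ} (hx : 0 < x) (hc₁ : 0 < c₁) (hc₂ : 0 < c₂)
    (hy : Real.log y = e) (hy0 : 0 < y) (h₁ : c₁ * y ≤ x) (h₂ : x ≤ c₂ * y) :
    |-Real.log x + e| ≤ |Real.log c₁| + |Real.log c₂| := by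
  have h3 := Real.log_le_log (by positivity) h₁
  have h4 := Real.log_le_log hx h₂
  rw [Real.log_mul hc₁.ne' hy0.ne', hy] at h3
  rw [Real.log_mul hc₂.ne' hy0.ne', hy] at h4
  have h5 := neg_abs_le (Real.log c₁)
  have h6 := le_abs_self (Real.log c₂)
  have h7 := abs_nonneg (Real.log c₁)
  have h8 := abs_nonneg (Real.log c₂)
  exact abs_le.2 ⟨by linarith, by linarith⟩

theorem eventually_neg_log_norm_approx {p : ℂ → ℂ} {δ : ℕ} {c₁ c₂ : ℝ} (hc₁ : 0 < c₁)
    (hc₂ : 0 < c₂) (hp : ∀ᶠ z in 𝓝 (0 : ℂ), c₁ * ‖z‖ ^ δ ≤ ‖p z‖ ∧ ‖p z‖ ≤ c₂ * ‖z‖ ^ δ)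
    {z : ℕ → ℂ} (hz : ∀ n, z (n + 1) = p (z n)) (hz0 : Tendsto z atTop (𝓝 0))
    (hzne : ∀ᶠ n in atTop, z n ≠ 0) :
    ∀ᶠ n in atTop, |-Real.log ‖z (n + 1)‖ - δ * -Real.log ‖z n‖| ≤
      |Real.log c₁| + |Real.log c₂| := by
  filter_upwards [hz0.eventually hp, hzne, (tendsto_add_atTop_nat 1).eventually hzne]
    with n h1 h2 h3
  rw [← hz] at h1
  have h4 : 0 < ‖z n‖ := norm_pos_iff.2 h2
  have := abs_neg_log_sub_le (norm_pos_iff.2 h3) hc₁ hc₂ (Real.log_pow ‖z n‖ δ) (by positivity)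
    h1.1 h1.2
  rwa [mul_neg, sub_neg_eq_add]

theorem eventually_eq_zero_of_eq_zero {p : ℂ → ℂ} {δ : ℕ} {c₁ c₂ : ℝ} (hδ : δ ≠ 0)
    (hp : ∀ᶠ z in 𝓝 (0 : ℂ), c₁ * ‖z‖ ^ δ ≤ ‖p z‖ ∧ ‖p z‖ ≤ c₂ * ‖z‖ ^ δ)
    {z : ℕ → ℂ} (hz : ∀ n, z (n + 1) = p (z n)) {N : ℕ} (hN : z N = 0) :
    ∀ᶠ n in atTop, z n = 0 := by
  have hp0 : p 0 = 0 := by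
    have := hp.self_of_nhds.2
    rw [norm_zero, zero_pow hδ, mul_zero] at this
    simpa using this
  refine eventually_atTop.2 ⟨N, fun n hn => ?_⟩
  induction n, hn using Nat.le_induction with
  | base => exact hN
  | succ n hn ih => rw [hz, ih, hp0]

/-- The Green function of the base at a point that is never mapped to `0`. -/
theorem exists_hasLogRate_base {p : ℂ → ℂ} {δ : ℕ} {c₁ c₂ : ℝ} (hδ : 2 ≤ δ) (hc₁ : 0 < c₁)
    (hc₂ : 0 < c₂) (hp : ∀ᶠ z in 𝓝 (0 : ℂ), c₁ * ‖z‖ ^ δ ≤ ‖p z‖ ∧ ‖p z‖ ≤ c₂ * ‖z‖ ^ δ)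
    {z : ℕ → ℂ} (hz : ∀ n, z (n + 1) = p (z n)) (hz0 : Tendsto z atTop (𝓝 0))
    (hzne : ∀ᶠ n in atTop, z n ≠ 0) :
    ∃ G : ℝ, Tendsto (fun n => Real.log ‖z n‖ / (δ : ℝ) ^ n) atTop (𝓝 G) ∧
      HasLogRate δ (fun n => ‖z n‖ₑ) G := by
  have hδ1 : (1 : ℝ) < δ := by exact_mod_cast hδ
  obtain ⟨G, hG⟩ := exists_tendsto_div_pow (ζ := fun n => -Real.log ‖z n‖) hδ1
    (eventually_neg_log_norm_approx hc₁ hc₂ hp hz hz0 hzne)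
  have hG' : Tendsto (fun n => Real.log ‖z n‖ / (δ : ℝ) ^ n) atTop (𝓝 (-G)) :=
    hG.neg.congr fun n => by ring
  exact ⟨-G, hG', (hasLogRate_enorm_iff hzne).2 (EReal.tendsto_coe.2 hG')⟩

/-- On the basin of `p` the limit defining the Green function exists and the orbit decays at least
like `exp (-c * δ ^ n)`; orbits that reach `0` are allowed. -/
theorem exists_hasLogRate_of_tendsto_zero {p : ℂ → ℂ} {δ : ℕ} {c₁ c₂ : ℝ} (hδ : 2 ≤ δ)
    (hc₁ : 0 < c₁) (hc₂ : 0 < c₂)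
    (hp : ∀ᶠ z in 𝓝 (0 : ℂ), c₁ * ‖z‖ ^ δ ≤ ‖p z‖ ∧ ‖p z‖ ≤ c₂ * ‖z‖ ^ δ)
    {z : ℕ → ℂ} (hz : ∀ n, z (n + 1) = p (z n)) (hz0 : Tendsto z atTop (𝓝 0)) :
    (∃ g, HasLogRate δ (fun n => ‖z n‖ₑ) g) ∧
      ∃ c, 0 < c ∧ ∀ᶠ n in atTop, ‖z n‖ ≤ Real.exp (-(c * (δ : ℝ) ^ n)) := by
  by_cases hzne : ∀ n, z n ≠ 0
  · have hzne' : ∀ᶠ n in atTop, z n ≠ 0 := Eventually.of_forall hzne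
    obtain ⟨G, -, hG⟩ := exists_hasLogRate_base hδ hc₁ hc₂ hp hz hz0 hzne'
    obtain ⟨c, hc, h⟩ := exists_pos_mul_pow_le (C := |Real.log c₁| + |Real.log c₂|)
      (show (1 : ℝ) < δ by exact_mod_cast hδ) (tendsto_neg_log_norm_atTop hz0 hzne')
      ((eventually_neg_log_norm_approx hc₁ hc₂ hp hz hz0 hzne').mono fun n hn => by
        linarith [(abs_le.1 hn).1])
    refine ⟨⟨G, hG⟩, c, hc, h.mono fun n hn => ?_⟩
    rw [← Real.log_le_iff_le_exp (norm_pos_iff.2 (hzne n))]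
    linarith
  · push Not at hzne
    obtain ⟨N, hN⟩ := hzne
    have hzN := eventually_eq_zero_of_eq_zero (by omega) hp hz hN
    refine ⟨⟨⊥, HasLogRate.bot_of_eventually_zero (by omega) (hzN.mono fun n hn => by simp [hn])⟩,
      1, one_pos, hzN.mono fun n hn => ?_⟩
    rw [hn, norm_zero]
    exact (Real.exp_pos _).le

/-! ### Vertical rates -/

/-- For an orbit that ends up in the wedge, `q` acts like the monomial of the last vertex, and the
vertical rate is `α` times the rate of the base. -/
theorem hasLogRate_of_eventually_mem_wedge {p : ℂ → ℂ} {q : ℂ × ℂ → ℂ} {δ γ d : ℕ}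
    {c₁ c₂ l α r₀ k₁ k₂ : ℝ} (hδ : 2 ≤ δ) (hdδ : d < δ) (hα : α * δ = γ + α * d)
    (hc₁ : 0 < c₁) (hc₂ : 0 < c₂)
    (hp : ∀ᶠ z in 𝓝 (0 : ℂ), c₁ * ‖z‖ ^ δ ≤ ‖p z‖ ∧ ‖p z‖ ≤ c₂ * ‖z‖ ^ δ)
    (hr₀ : 0 < r₀) (hk₁ : 0 < k₁) (hk₂ : 0 < k₂)
    (hq : ∀ z w : ℂ, z ≠ 0 → ‖z‖ < r₀ → ‖w‖ ≤ r₀ * ‖z‖ ^ l →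
      k₁ * (‖z‖ ^ γ * ‖w‖ ^ d) ≤ ‖q (z, w)‖ ∧ ‖q (z, w)‖ ≤ k₂ * (‖z‖ ^ γ * ‖w‖ ^ d))
    {z w : ℕ → ℂ} (hz : ∀ n, z (n + 1) = p (z n)) (hw : ∀ n, w (n + 1) = q (z n, w n))
    (hz0 : Tendsto z atTop (𝓝 0)) (hzne : ∀ᶠ n in atTop, z n ≠ 0)
    (hwedge : ∀ᶠ n in atTop, ‖w n‖ ≤ r₀ * ‖z n‖ ^ l) (hne : d = 0 ∨ ∀ n, w n ≠ 0) :
    ∃ g : EReal, HasLogRate δ (fun n => ‖z n‖ₑ) g ∧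
      HasLogRate δ (fun n => ‖w n‖ₑ) ((α : EReal) * g) := by
  have hbounds : ∀ᶠ n in atTop, k₁ * (‖z n‖ ^ γ * ‖w n‖ ^ d) ≤ ‖w (n + 1)‖ ∧
      ‖w (n + 1)‖ ≤ k₂ * (‖z n‖ ^ γ * ‖w n‖ ^ d) := by
    filter_upwards [hzne, hz0.norm.eventually_lt_const (by simpa using hr₀), hwedge]
      with n h1 h2 h3
    rw [hw]
    exact hq _ _ h1 h2 h3
  -- when `d = 0` the lower bound already forces `w n ≠ 0`
  have hwne : ∀ᶠ n in atTop, w n ≠ 0 := by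
    rcases hne with rfl | hne
    · have : ∀ᶠ n in atTop, w (n + 1) ≠ 0 := by
        filter_upwards [hbounds, hzne] with n h1 h2
        have h3 : 0 < ‖z n‖ := norm_pos_iff.2 h2
        exact norm_pos_iff.1 (lt_of_lt_of_le (by positivity) h1.1)
      obtain ⟨N, hN⟩ := eventually_atTop.1 this
      refine eventually_atTop.2 ⟨N + 1, fun n hn => ?_⟩
      obtain ⟨k, rfl⟩ := Nat.exists_eq_add_of_le' (le_trans (Nat.le_add_left 1 N) hn)
      exact hN k (by omega)
    · exact Eventually.of_forall hne
  obtain ⟨G, hG, hGz⟩ := exists_hasLogRate_base hδ hc₁ hc₂ hp hz hz0 hzne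
  refine ⟨G, hGz, HasLogRate.of_tendsto_weighted_diff hG hwne ?_⟩
  refine tendsto_weighted_diff_of_monomial (γ := γ) (d := d)
    (C' := |Real.log k₁| + |Real.log k₂|) (by exact_mod_cast hδ) d.cast_nonneg
    (by exact_mod_cast hdδ) hα (eventually_neg_log_norm_approx hc₁ hc₂ hp hz hz0 hzne) ?_
  filter_upwards [hbounds, hzne, hwne, (tendsto_add_atTop_nat 1).eventually hwne]
    with n h1 h2 h3 h4
  have hzn : 0 < ‖z n‖ := norm_pos_iff.2 h2
  have hwn : 0 < ‖w n‖ := norm_pos_iff.2 h3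
  have := abs_neg_log_sub_le (norm_pos_iff.2 h4) hk₁ hk₂
    (show Real.log (‖z n‖ ^ γ * ‖w n‖ ^ d) = γ * Real.log ‖z n‖ + d * Real.log ‖w n‖ by
      rw [Real.log_mul (by positivity) (by positivity), Real.log_pow, Real.log_pow])
    (by positivity) h1.1 h1.2
  convert this using 2
  ring

/-- For `d < δ`, on every orbit that converges to the origin and that does not meet `w = 0` (no
restriction if `d = 0`), the vertical rate is `α` times the rate of the base. Either the orbit enters
the wedge, or it stays outside for ever; in both cases the two rates are compared by a contraction. -/
theorem hasLogRate_of_tendsto_zero {p : ℂ → ℂ} {q : ℂ × ℂ → ℂ} {b : ℕ → ℕ → ℂ}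
    {δ γ d n' m' : ℕ} {c₁ c₂ l α ε r η : ℝ} (hδ : 2 ≤ δ) (hdδ : d < δ)
    (hα : α * δ = γ + α * d) (hl : 0 < l) (hlα : l ≤ α) (hε : 0 < ε) (hc₁ : 0 < c₁) (hc₂ : 0 < c₂)
    (hp : ∀ᶠ z in 𝓝 (0 : ℂ), c₁ * ‖z‖ ^ δ ≤ ‖p z‖ ∧ ‖p z‖ ≤ c₂ * ‖z‖ ^ δ)
    (hb : IsPowerSeriesCoeff q b) {r₀ k₁ k₂ : ℝ} (hr₀ : 0 < r₀) (hk₁ : 0 < k₁) (hk₂ : 0 < k₂)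
    (hq : ∀ z w : ℂ, z ≠ 0 → ‖z‖ < r₀ → ‖w‖ ≤ r₀ * ‖z‖ ^ l →
      k₁ * (‖z‖ ^ γ * ‖w‖ ^ d) ≤ ‖q (z, w)‖ ∧ ‖q (z, w)‖ ≤ k₂ * (‖z‖ ^ γ * ‖w‖ ^ d))
    (hn'0 : 0 < n') (hm' : m' < δ) (hn' : (n' : ℝ) = α * (δ - m'))
    (hsupp : ∀ i j, b i j ≠ 0 → (n' ≤ i ∧ (n' : ℝ) + l * m' ≤ i + l * j) ∨
      (i ≤ n' ∧ l * (δ + ε) ≤ i + l * j))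
    (hr : 0 < r) (hrr₀ : r ≤ r₀) (hη : 0 < η)
    (hinv : ∀ z w : ℂ, z ≠ 0 → ‖z‖ < η → ‖w‖ < r * ‖z‖ ^ l → ‖q (z, w)‖ < r * ‖p z‖ ^ l)
    {z w : ℕ → ℂ} (hz : ∀ n, z (n + 1) = p (z n)) (hw : ∀ n, w (n + 1) = q (z n, w n))
    (hz0 : Tendsto z atTop (𝓝 0)) (hw0 : Tendsto w atTop (𝓝 0))
    (hne : d = 0 ∨ ∀ n, w n ≠ 0) :
    ∃ g : EReal, HasLogRate δ (fun n => ‖z n‖ₑ) g ∧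
      HasLogRate δ (fun n => ‖w n‖ₑ) ((α : EReal) * g) := by
  have hα0 : 0 < α := hl.trans_le hlα
  have hδ1 : (1 : ℝ) < δ := by exact_mod_cast hδ
  by_cases hzne : ∀ n, z n ≠ 0
  swap
  · -- the orbit runs into the invariant fibre `z = 0`, on which `q` vanishes to order `> δ`
    push Not at hzne
    obtain ⟨N, hN⟩ := hzne
    have hzN := eventually_eq_zero_of_eq_zero (by omega) hp hz hN
    have hJ : ∀ j, b 0 j ≠ 0 → δ + 1 ≤ j := by
      intro j hj
      rcases hsupp 0 j hj with ⟨h1, -⟩ | ⟨-, h2⟩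
      · omega
      · have h3 : l * (δ + ε) ≤ l * j := by simpa using h2
        have h4 : (δ : ℝ) < j := by linarith [le_of_mul_le_mul_left h3 hl]
        exact_mod_cast h4
    obtain ⟨C, hC, hqC⟩ := hb.exists_norm_le_pow_on_fiber hJ
    refine ⟨⊥, HasLogRate.bot_of_eventually_zero (by omega) (hzN.mono fun n hn => by simp [hn]), ?_⟩
    rw [EReal.coe_mul_bot_of_pos hα0]
    refine hasLogRate_bot_of_norm_le_pow_succ hδ hC hw0 ?_
    filter_upwards [hw0.eventually hqC, hzN] with n h1 h2
    rw [hw, h2]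
    exact h1
  have hzne' : ∀ᶠ n in atTop, z n ≠ 0 := Eventually.of_forall hzne
  by_cases hfreq : ∃ᶠ n in atTop, ‖w n‖ < r * ‖z n‖ ^ l
  · -- once in the wedge, always in the wedge
    obtain ⟨N, hN⟩ := eventually_atTop.1 (hz0.norm.eventually_lt_const (by simpa using hη))
    obtain ⟨N', hN', hwN⟩ := frequently_atTop.1 hfreq N
    have hwedge : ∀ n, N' ≤ n → ‖w n‖ < r * ‖z n‖ ^ l := by
      intro n hn
      induction n, hn using Nat.le_induction with
      | base => exact hwN
      | succ n hn ih =>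
        rw [hz, hw]
        exact hinv _ _ (hzne n) (hN n (by omega)) ih
    refine hasLogRate_of_eventually_mem_wedge hδ hdδ hα hc₁ hc₂ hp hr₀ hk₁ hk₂ hq hz hw hz0
      hzne' (eventually_atTop.2 ⟨N', fun n hn => (hwedge n hn).le.trans ?_⟩) hne
    gcongr
  · -- never in the wedge: the lower bound for `|w n|` is then automatic
    have hout : ∀ᶠ n in atTop, r * ‖z n‖ ^ l ≤ ‖w n‖ :=
      (not_frequently.1 hfreq).mono fun n hn => not_lt.1 hn
    have hzpos : ∀ n, 0 < ‖z n‖ := fun n => norm_pos_iff.2 (hzne n)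
    have hwne : ∀ᶠ n in atTop, w n ≠ 0 := hout.mono fun n hn =>
      norm_pos_iff.1 (lt_of_lt_of_le (mul_pos hr (Real.rpow_pos_of_pos (hzpos n) l)) hn)
    have hlog : ∀ᶠ n in atTop, -Real.log ‖w n‖ ≤ l * -Real.log ‖z n‖ + -Real.log r := by
      filter_upwards [hout] with n hn
      have h1 := Real.rpow_pos_of_pos (hzpos n) l
      have := Real.log_le_log (mul_pos hr h1) hn
      rw [Real.log_mul hr.ne' h1.ne', Real.log_rpow (hzpos n)] at this
      linarith
    obtain ⟨G, hG, hGz⟩ := exists_hasLogRate_base hδ hc₁ hc₂ hp hz hz0 hzne'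
    refine ⟨G, hGz, HasLogRate.of_tendsto_weighted_diff hG hwne ?_⟩
    obtain ⟨C₁, hC₁⟩ := hb.exists_neg_log_norm_ge_of_not_mem_wedge hl (by linarith) hε hn' hsupp
      (-Real.log r)
    refine tendsto_weighted_diff_of_min (μ := m') (C₁ := C₁) hδ1 hl hlα m'.cast_nonneg
      (by exact_mod_cast hm') hε (tendsto_neg_log_norm_atTop hz0 hzne')
      (tendsto_neg_log_norm_atTop hw0 hwne)
      (eventually_neg_log_norm_approx hc₁ hc₂ hp hz hz0 hzne') hlog ?_
    filter_upwards [(hz0.prodMk_nhds hw0).eventually hC₁, hwne,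
      (tendsto_add_atTop_nat 1).eventually hwne, hlog] with n h1 h2 h3 h4
    rw [hw] at h3 ⊢
    exact h1 (hzne n) h2 h3 h4

/-- The case `δ < d`: the coefficient of `w ^ d` tends to `0`, so the vertical rate exists by
monotonicity, and the base is negligible at the scale `d ^ n`. -/
theorem hasLogRate_of_degree_lt {p : ℂ → ℂ} {q : ℂ × ℂ → ℂ} {b : ℕ → ℕ → ℂ}
    {δ γ d : ℕ} {c₁ c₂ α : ℝ} (hδ : 2 ≤ δ) (hδd : δ < d) (hγ : 0 < γ) (hα : α < 0)
    (hc₁ : 0 < c₁) (hc₂ : 0 < c₂)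
    (hp : ∀ᶠ z in 𝓝 (0 : ℂ), c₁ * ‖z‖ ^ δ ≤ ‖p z‖ ∧ ‖p z‖ ≤ c₂ * ‖z‖ ^ δ)
    (hb : IsPowerSeriesCoeff q b) (hlow : ∀ i j, b i j ≠ 0 → d ≤ j ∧ (j = d → γ ≤ i))
    {z w : ℕ → ℂ} (hz : ∀ n, z (n + 1) = p (z n)) (hw : ∀ n, w (n + 1) = q (z n, w n))
    (hz0 : Tendsto z atTop (𝓝 0)) (hw0 : Tendsto w atTop (𝓝 0)) :
    (∃ g, HasLogRate d (fun n => ‖w n‖ₑ) g ∧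
      HasLogRate d (fun n => ‖w n‖ₑ / ‖z n‖ₑ ^ α) g) ∧
    ((∀ n, z n ≠ 0) → HasLogRate d (fun n => max ‖z n‖ₑ ‖w n‖ₑ) 0) := by
  obtain ⟨C, hC, hqC⟩ := hb.exists_norm_le_pow_mul_max hγ hlow
  have hmono : ∀ᶠ n in atTop, ‖w (n + 1)‖ ≤ ‖w n‖ ^ d := by
    have hmax : Tendsto (fun n => C * max ‖z n‖ ‖w n‖) atTop (𝓝 0) := by
      simpa using (hz0.norm.max hw0.norm).const_mul C
    filter_upwards [(hz0.prodMk_nhds hw0).eventually hqC, hmax.eventually_le_const one_pos]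
      with n h1 h2
    rw [hw]
    calc ‖q (z n, w n)‖ ≤ C * (‖w n‖ ^ d * max ‖z n‖ ‖w n‖) := h1
      _ = ‖w n‖ ^ d * (C * max ‖z n‖ ‖w n‖) := by ring
      _ ≤ ‖w n‖ ^ d * 1 := by gcongr
      _ = ‖w n‖ ^ d := mul_one _
  obtain ⟨g, hg⟩ := exists_hasLogRate_of_norm_le_pow (by omega) hmono
  -- the base decays only at the smaller rate `δ`
  have hbase : (∀ n, z n ≠ 0) →
      Tendsto (fun n => Real.log ‖z n‖ / (d : ℝ) ^ n) atTop (𝓝 0) := by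
    intro hzne
    obtain ⟨G, hG, -⟩ := exists_hasLogRate_base hδ hc₁ hc₂ hp hz hz0 (Eventually.of_forall hzne)
    have hδ0 : (0 : ℝ) < δ := by exact_mod_cast (by omega : 0 < δ)
    have hd0 : (0 : ℝ) < d := by exact_mod_cast (by omega : 0 < d)
    have hratio : Tendsto (fun n : ℕ => ((δ : ℝ) / d) ^ n) atTop (𝓝 0) :=
      tendsto_pow_atTop_nhds_zero_of_lt_one (by positivity)
        ((div_lt_one hd0).2 (by exact_mod_cast hδd))
    have := hG.mul hratio
    rw [mul_zero] at this
    refine this.congr fun n => ?_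
    rw [div_pow]
    field_simp
  refine ⟨?_, fun hzne => ?_⟩
  · by_cases hzne : ∀ n, z n ≠ 0
    · exact ⟨g, hg, hg.div_rpow (Eventually.of_forall hzne) (hbase hzne)⟩
    · push Not at hzne
      obtain ⟨N, hN⟩ := hzne
      have hzN := eventually_eq_zero_of_eq_zero (by omega) hp hz hN
      have hJ : ∀ j, b 0 j ≠ 0 → d + 1 ≤ j := by
        intro j hj
        obtain ⟨h1, h2⟩ := hlow 0 j hj
        rcases h1.eq_or_lt with h3 | h3
        · have := h2 h3.symm
          omega
        · exact h3
      obtain ⟨C', hC', hqC'⟩ := hb.exists_norm_le_pow_on_fiber hJ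
      refine ⟨⊥, hasLogRate_bot_of_norm_le_pow_succ (by omega) hC' hw0 ?_,
        HasLogRate.bot_of_eventually_zero (by omega) (hzN.mono fun n hn => ?_)⟩
      · filter_upwards [hw0.eventually hqC', hzN] with n h1 h2
        rw [hw, h2]
        exact h1
      · rw [hn, enorm_zero, ENNReal.zero_rpow_of_neg hα, ENNReal.div_top]
  · have hz' : HasLogRate d (fun n => ‖z n‖ₑ) 0 :=
      (hasLogRate_enorm_iff (Eventually.of_forall hzne)).2
        (EReal.tendsto_coe.2 (hbase hzne))
    have hg0 : g ≤ 0 := by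
      refine le_of_tendsto hg ?_
      filter_upwards [hw0.norm.eventually_le_const (by simp : ‖(0 : ℂ)‖ < 1)] with n hn
      refine mul_nonpos_of_nonneg_of_nonpos
        (by exact_mod_cast (by positivity : (0 : ℝ) ≤ ((d : ℝ) ^ n)⁻¹)) ?_
      rw [← ENNReal.log_one]
      refine ENNReal.log_monotone ?_
      rw [← enorm_one (G := ℂ), enorm_le_iff_norm_le]
      simpa using hn
    have := hz'.max hg
    rwa [max_eq_left hg0] at this

/-- The case `δ = d`: the coefficient of `w ^ d` vanishes at the origin, and along the orbit it is
exponentially small in `δ ^ n`. -/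
theorem hasLogRate_of_degree_eq {p : ℂ → ℂ} {q : ℂ × ℂ → ℂ} {b : ℕ → ℕ → ℂ}
    {δ γ : ℕ} {c₁ c₂ : ℝ} (hδ : 2 ≤ δ) (hγ : 0 < γ) (hc₁ : 0 < c₁) (hc₂ : 0 < c₂)
    (hp : ∀ᶠ z in 𝓝 (0 : ℂ), c₁ * ‖z‖ ^ δ ≤ ‖p z‖ ∧ ‖p z‖ ≤ c₂ * ‖z‖ ^ δ)
    (hb : IsPowerSeriesCoeff q b) (hlow : ∀ i j, b i j ≠ 0 → δ ≤ j ∧ (j = δ → γ ≤ i))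
    {z w : ℕ → ℂ} (hz : ∀ n, z (n + 1) = p (z n)) (hw : ∀ n, w (n + 1) = q (z n, w n))
    (hz0 : Tendsto z atTop (𝓝 0)) (hw0 : Tendsto w atTop (𝓝 0)) :
    HasLogRate δ (fun n => ‖w n‖ₑ) ⊥ := by
  obtain ⟨C, hC, hqC⟩ := hb.exists_norm_le_pow_mul_max hγ hlow
  obtain ⟨-, c, hc, hzc⟩ := exists_hasLogRate_of_tendsto_zero hδ hc₁ hc₂ hp hz hz0
  refine hasLogRate_bot_of_norm_le hδ hc hC hw0 ?_
  filter_upwards [(hz0.prodMk_nhds hw0).eventually hqC, hzc] with n h1 h2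
  rw [hw]
  refine h1.trans ?_
  gcongr

/-! ### Iterates of the skew product and the Green functions -/

theorem skewProduct_iterate_fst (p : ℂ → ℂ) (q : ℂ × ℂ → ℂ) (x : ℂ × ℂ) (n : ℕ) :
    ((skewProduct p q)^[n] x).1 = p^[n] x.1 := by
  induction n with
  | zero => rfl
  | succ n ih => rw [Function.iterate_succ_apply', Function.iterate_succ_apply', ← ih]; rfl

theorem skewProduct_iterate_succ_fst (p : ℂ → ℂ) (q : ℂ × ℂ → ℂ) (x : ℂ × ℂ) (n : ℕ) :
    ((skewProduct p q)^[n + 1] x).1 = p ((skewProduct p q)^[n] x).1 := by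
  rw [Function.iterate_succ_apply']; rfl

theorem skewProduct_iterate_succ_snd (p : ℂ → ℂ) (q : ℂ × ℂ → ℂ) (x : ℂ × ℂ) (n : ℕ) :
    ((skewProduct p q)^[n + 1] x).2 =
      q (((skewProduct p q)^[n] x).1, ((skewProduct p q)^[n] x).2) := by
  rw [Function.iterate_succ_apply']; rfl

theorem isGp_iff {p : ℂ → ℂ} {q : ℂ × ℂ → ℂ} {δ : ℕ} {x : ℂ × ℂ} {g : EReal} :
    IsGp p δ x.1 g ↔ HasLogRate δ (fun n => ‖((skewProduct p q)^[n] x).1‖ₑ) g := by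
  simp only [IsGp, skewProduct_iterate_fst]

theorem mainTheorem4
    -- `f = (p, q)` is holomorphic on `Ω = D × ℂ`, where `D` is `ℂ` or a disc in which the
    -- basin `A_p` is relatively compact
    (D : Set ℂ) (p : ℂ → ℂ) (q : ℂ × ℂ → ℂ)
    (hD : D = univ ∨ ∃ R : ℝ, 0 < R ∧ D = Metric.ball 0 R ∧
      IsCompact (closure (basin D p 0)) ∧ closure (basin D p 0) ⊆ D)
    (hp : DifferentiableOn ℂ p D) (hq : DifferentiableOn ℂ q (D ×ˢ univ))
    -- the origin is a fixed point at which both eigenvalues of the derivative vanish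
    (δ : ℕ) (hδ : 2 ≤ δ) (hpδ : analyticOrderAt p 0 = (δ : ℕ∞))
    (b : ℕ → ℕ → ℂ) (hb : IsPowerSeriesCoeff q b) (hb00 : b 0 0 = 0) (hb01 : b 0 1 = 0)
    -- the Newton polygon of `q` and its last vertex
    (s : ℕ) (hs : 1 < s) (n m : ℕ → ℕ) (hv : IsVertexList b s n m)
    (γ d : ℕ) (hγ : γ = n s) (hd : d = m s)
    (α : ℝ) (hα : α = (γ : ℝ) / ((δ : ℝ) - (d : ℝ)))
    (l₁ : ℝ) (hl₁ : l₁ = ((n s : ℝ) - (n (s - 1) : ℝ)) / ((m (s - 1) : ℝ) - (m s : ℝ)))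
    (T : ℝ) (hT : T = yIntercept n m (s - 1))
    (lam : ℕ) (hlam : lam = max δ d)
    (Ω : Set (ℂ × ℂ)) (hΩ : Ω = D ×ˢ univ)
    (f : ℂ × ℂ → ℂ × ℂ) (hf : f = skewProduct p q)
    (A₀ Ez Ew : Set (ℂ × ℂ)) (hA₀ : A₀ = basin Ω f 0)
    (hEz : Ez = allPreimages Ω f {x | x.1 = 0}) (hEw : Ew = allPreimages Ω f {x | x.2 = 0}) :
    ((δ : ℝ) < T →
      (δ < d →
        (∀ x ∈ A₀, ∃ g : EReal, IsGz f lam x g ∧ IsGzWeighted f d α x g) ∧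
        (∀ x ∈ A₀ \ Ez, IsGf f lam x 0)) ∧
      (δ = d →
        (∀ x ∈ A₀, IsGz f lam x ⊥) ∧
        (∀ x ∈ A₀, ∃ g : EReal, IsGp p δ x.1 g ∧ IsGf f lam x g)) ∧
      (d < δ → 1 ≤ d →
        (∀ x ∈ A₀ \ Ew, ∃ g : EReal, IsGp p δ x.1 g ∧ IsGz f lam x ((α : EReal) * g)) ∧
        (∀ x ∈ Ew, (∀ k : ℕ, f^[k] x ∈ Ω) → IsGz f lam x ⊥)) ∧
      (d = 0 →
        ∀ x ∈ A₀, ∃ g : EReal, IsGp p δ x.1 g ∧ IsGz f lam x ((α : EReal) * g)) ∧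
      (d < δ →
        ∀ x ∈ A₀, ∃ g : EReal, IsGp p δ x.1 g ∧ IsGfWeighted f lam α x ((α : EReal) * g))) ∧
    (T = (δ : ℝ) → d < δ → 2 ≤ d →
      (∃ r₀ : ℝ, 0 < r₀ ∧ ∀ r : ℝ, 0 < r → r < r₀ →
        (∀ x ∈ allPreimages Ω f (wedge l₁ r) \ Ew, ∃ g : EReal,
          IsGp p δ x.1 g ∧ IsGz f lam x ((α : EReal) * g)) ∧
        (∀ x ∈ allPreimages Ω f (wedge l₁ r), ∃ g : EReal,
          IsGp p δ x.1 g ∧ IsGfWeighted f lam α x ((α : EReal) * g))) ∧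
      (∀ x ∈ Ew, (∀ k : ℕ, f^[k] x ∈ Ω) → IsGz f lam x ⊥) ∧
      (0 < n (s - 1) →
        (∀ x ∈ A₀ \ Ew, ∃ g : EReal, IsGp p δ x.1 g ∧ IsGz f lam x ((α : EReal) * g)) ∧
        (∀ x ∈ A₀, ∃ g : EReal,
          IsGp p δ x.1 g ∧ IsGfWeighted f lam α x ((α : EReal) * g)))) := by
  obtain ⟨hDo, hDc, h0D⟩ : IsOpen D ∧ IsPreconnected D ∧ (0 : ℂ) ∈ D := by
    rcases hD with rfl | ⟨R, hR, rfl, -, -⟩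
    · exact ⟨isOpen_univ, isPreconnected_univ, mem_univ _⟩
    · exact ⟨Metric.isOpen_ball, (convex_ball _ _).isPreconnected, Metric.mem_ball_self hR⟩
  obtain ⟨c₁, c₂, hc₁, hc₂, hpb⟩ :=
    exists_norm_bounds_of_analyticOrderAt (hp.analyticOnNhd hDo 0 h0D) hpδ
  subst hf hA₀ hEz hEw hΩ
  -- the Newton polygon near its last edge
  have hn := hv.n_lt (s - 1) s (by omega) (by omega) le_rfl
  have hm := hv.m_gt (s - 1) s (by omega) (by omega) le_rfl
  have hnR : (n (s - 1) : ℝ) < n s := by exact_mod_cast hn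
  have hmR : (m s : ℝ) < m (s - 1) := by exact_mod_cast hm
  have hγ0 : 0 < γ := by omega
  have hγR : (0 : ℝ) < γ := by exact_mod_cast hγ0
  have hl0 : 0 < l₁ := by rw [hl₁]; exact div_pos (by linarith) (by linarith)
  have hlT : l₁ * T = γ + l₁ * d := by
    rw [hT, yIntercept, show s - 1 + 1 = s by omega, hl₁, hγ, hd]
    field_simp [(sub_pos.2 hmR).ne', (sub_pos.2 hnR).ne']
    ring
  have hγd : b γ d ≠ 0 := by rw [hγ, hd]; exact hv.coeff_ne_zero hs.le le_rfl
  have hlow : ∀ i j, b i j ≠ 0 → d ≤ j ∧ (j = d → γ ≤ i) := fun i j hij => by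
    rw [hγ, hd]; exact hv.lowest_vertex hs.le hij
  have hedge : ∀ i j, b i j ≠ 0 → (γ : ℝ) + l₁ * d ≤ i + l₁ * j := fun i j hij => by
    rw [hγ, hd]; exact (hv.last_edge hs hl₁ hij).1
  obtain ⟨r₀, k₁, k₂, hr₀, hk₁, hk₂, hqb⟩ :=
    hb.exists_norm_bounds_in_wedge hl0 hγd hlow hedge
  have hαδ : d < δ → α * δ = γ + α * d := fun h => by
    have : (d : ℝ) < δ := by exact_mod_cast h
    rw [hα]
    field_simp [(sub_pos.2 this).ne']
    ring
  have hαpos : d < δ → 0 < α := fun h => by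
    have : (d : ℝ) < δ := by exact_mod_cast h
    rw [hα]; exact div_pos hγR (by linarith)
  have hlα : d < δ → (δ : ℝ) ≤ T → l₁ ≤ α := fun h hT' => by
    have : (d : ℝ) < δ := by exact_mod_cast h
    rw [hα, le_div_iff₀ (by linarith)]
    have := mul_le_mul_of_nonneg_left hT' hl0.le
    linarith
  set F := skewProduct p q with hF
  have hfst := skewProduct_iterate_succ_fst p q
  have hsnd := skewProduct_iterate_succ_snd p q
  rw [← hF] at hfst hsnd
  have hfst0 : ∀ x ∈ basin (D ×ˢ univ) F 0, Tendsto (fun k => (F^[k] x).1) atTop (𝓝 0) :=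
    fun x hx => (continuous_fst.tendsto (0 : ℂ × ℂ)).comp hx.2
  have hsnd0 : ∀ x ∈ basin (D ×ˢ univ) F 0, Tendsto (fun k => (F^[k] x).2) atTop (𝓝 0) :=
    fun x hx => (continuous_snd.tendsto (0 : ℂ × ℂ)).comp hx.2
  have hGp : ∀ x ∈ basin (D ×ˢ univ) F 0, ∃ g, IsGp p δ x.1 g := fun x hx => by
    obtain ⟨⟨g, hg⟩, -⟩ :=
      exists_hasLogRate_of_tendsto_zero hδ hc₁ hc₂ hpb (hfst x) (hfst0 x hx)
    exact ⟨g, isGp_iff.2 hg⟩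
  -- for `d ≥ 1` the line `w = 0` is invariant
  have hzero : 1 ≤ d → ∀ z ∈ D, q (z, 0) = 0 := by
    intro h1
    have han : AnalyticOnNhd ℂ (fun z : ℂ => q (z, 0)) D :=
      DifferentiableOn.analyticOnNhd (hq.comp (g := q) (f := fun z : ℂ => (z, (0 : ℂ)))
        (by fun_prop) fun z hz => ⟨hz, mem_univ _⟩) hDo
    refine fun z hz => han.eqOn_zero_of_preconnected_of_eventuallyEq_zero hDc h0D
      (hb.eventually_eq_zero_of_coeff_eq_zero fun i => ?_) hz
    by_contra hi
    have := (hlow i 0 hi).1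
    omega
  have hEwbot : 1 ≤ d → ∀ x, (∀ k, F^[k] x ∈ D ×ˢ (univ : Set ℂ)) →
      ∀ N, (F^[N] x).2 = 0 → IsGz F lam x ⊥ := by
    intro h1 x hx N hN
    refine HasLogRate.bot_of_eventually_zero (by omega) (eventually_atTop.2 ⟨N, fun k hk => ?_⟩)
    induction k, hk using Nat.le_induction with
    | base => simp [hN]
    | succ k hk ih =>
      rw [enorm_eq_zero] at ih ⊢
      rw [hsnd, ih]
      exact hzero h1 _ (hx k).1
  have hEw : 1 ≤ d → ∀ x ∈ allPreimages (D ×ˢ univ) F {x | x.2 = 0},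
      (∀ k, F^[k] x ∈ D ×ˢ (univ : Set ℂ)) → IsGz F lam x ⊥ :=
    fun h1 x ⟨N, _, hN⟩ hx => hEwbot h1 x hx N hN
  have hnotEw : ∀ x, (∀ k, F^[k] x ∈ D ×ˢ (univ : Set ℂ)) →
      x ∉ allPreimages (D ×ˢ univ) F {x | x.2 = 0} → ∀ k, (F^[k] x).2 ≠ 0 :=
    fun x hx hxE k hk => hxE ⟨k, fun j _ => hx j, hk⟩
  -- the weighted Green function only needs the upper bound `h ≤ α g` for the vertical rate
  have hGfα : d < δ → ∀ x g h, IsGp p δ x.1 g → IsGz F lam x h → h ≤ (α : EReal) * g →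
      IsGfWeighted F lam α x ((α : EReal) * g) := by
    intro hdδ x g h hg hh hle
    have hlam' : lam = δ := by omega
    subst hlam'
    have := ((isGp_iff (q := q)).1 hg).rpow (hαpos hdδ).ne' |>.max hh
    rwa [max_eq_left hle] at this
  -- the two forms of the disjunction are an intercept greater than `δ` and an intercept equal to `δ`
  have hbasin : d < δ → (l₁ * δ < γ + l₁ * d ∨ (T = δ ∧ 2 ≤ d ∧ 0 < n (s - 1))) →
      ∀ x ∈ basin (D ×ˢ univ) F 0, (d = 0 ∨ ∀ k, (F^[k] x).2 ≠ 0) →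
      ∃ g : EReal, IsGp p δ x.1 g ∧ IsGz F lam x ((α : EReal) * g) := by
    intro hdδ hcase x hx hne
    have hlam' : lam = δ := by omega
    have hT' : (δ : ℝ) ≤ T := by
      rcases hcase with h | h
      · rw [← hlT] at h; exact (lt_of_mul_lt_mul_left h hl0.le).le
      · exact h.1.ge
    obtain ⟨n', m', ε, hε, hn'0, hm', hn', hsupp⟩ := hv.exists_support_dichotomy hs hl0 hl₁
      (δ := δ) (α := α) (by omega) (by rw [← hγ, ← hd]; exact hαδ hdδ) (by
        rw [← hγ, ← hd]
        exact hcase.imp_right fun h => ⟨by rw [← h.1, hlT], h.2.2⟩)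
    obtain ⟨r, η, hr, hrr₀, hη, hinv⟩ : ∃ r η : ℝ, 0 < r ∧ r ≤ r₀ ∧ 0 < η ∧
        ∀ z w : ℂ, z ≠ 0 → ‖z‖ < η → ‖w‖ < r * ‖z‖ ^ l₁ → ‖q (z, w)‖ < r * ‖p z‖ ^ l₁ := by
      rcases hcase with h | ⟨h, h2, -⟩
      · obtain ⟨η, hη, hinv⟩ := exists_wedge_forward_invariant hl0 hc₁ hk₂ hr₀ le_rfl hpb hqb h
        exact ⟨r₀, η, hr₀, le_rfl, hη, hinv⟩
      · obtain ⟨r₁, hr₁, hr₁₀, hinv⟩ := exists_wedge_forward_invariant_of_eq hl0 hc₁ hk₂ hr₀ hpb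
          hqb (by rw [← h, hlT]) h2
        exact ⟨r₁ / 2, r₁, half_pos hr₁, by linarith, hr₁, hinv _ (half_pos hr₁) (by linarith)⟩
    obtain ⟨g, hg, hg'⟩ := hasLogRate_of_tendsto_zero hδ hdδ (hαδ hdδ) hl0 (hlα hdδ hT') hε hc₁
      hc₂ hpb hb hr₀ hk₁ hk₂ hqb hn'0 hm' hn' hsupp hr hrr₀ hη hinv (hfst x) (hsnd x)
      (hfst0 x hx) (hsnd0 x hx) hne
    rw [← hlam'] at hg'
    exact ⟨g, isGp_iff.2 hg, hg'⟩
  have hbasinα : d < δ → (l₁ * δ < γ + l₁ * d ∨ (T = δ ∧ 2 ≤ d ∧ 0 < n (s - 1))) →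
      ∀ x ∈ basin (D ×ˢ univ) F 0,
      ∃ g : EReal, IsGp p δ x.1 g ∧ IsGfWeighted F lam α x ((α : EReal) * g) := by
    intro hdδ hcase x hx
    by_cases hne : d = 0 ∨ ∀ k, (F^[k] x).2 ≠ 0
    · obtain ⟨g, hg, hg'⟩ := hbasin hdδ hcase x hx hne
      exact ⟨g, hg, hGfα hdδ x g _ hg hg' le_rfl⟩
    · push Not at hne
      obtain ⟨hd0, N, hN⟩ := hne
      obtain ⟨g, hg⟩ := hGp x hx
      exact ⟨g, hg, hGfα hdδ x g _ hg (hEwbot (by omega) x hx.1 N hN) bot_le⟩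
  refine ⟨fun hδT => ⟨fun hδd => ?_, fun hδd => ?_, fun hdδ hd1 => ⟨?_, hEw hd1⟩, fun hd0 => ?_,
    fun hdδ => ?_⟩, fun hTδ hdδ hd2 => ⟨?_, hEw (by omega), fun hpos => ⟨?_, ?_⟩⟩⟩
  · have hlam' : lam = d := by omega
    rw [hlam']
    have hα0 : α < 0 := by
      have : (δ : ℝ) < d := by exact_mod_cast hδd
      rw [hα]; exact div_neg_of_pos_of_neg hγR (by linarith)
    have hkey := fun x (hx : x ∈ basin (D ×ˢ univ) F 0) => hasLogRate_of_degree_lt hδ hδd hγ0 hα0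
      hc₁ hc₂ hpb hb hlow (hfst x) (hsnd x) (hfst0 x hx) (hsnd0 x hx)
    exact ⟨fun x hx => (hkey x hx).1, fun x hx => (hkey x hx.1).2 fun k hk =>
      hx.2 ⟨k, fun j _ => hx.1.1 j, hk⟩⟩
  · have hlam' : lam = δ := by omega
    rw [← hδd] at hlow
    have hkey : ∀ x ∈ basin (D ×ˢ univ) F 0, IsGz F lam x ⊥ := fun x hx => by
      rw [hlam']
      exact hasLogRate_of_degree_eq hδ hγ0 hc₁ hc₂ hpb hb hlow (hfst x) (hsnd x) (hfst0 x hx)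
        (hsnd0 x hx)
    refine ⟨hkey, fun x hx => ?_⟩
    obtain ⟨g, hg⟩ := hGp x hx
    have := (isGp_iff (q := q)).1 hg
    rw [← hlam'] at this
    have := this.max (hkey x hx)
    rw [max_eq_left bot_le] at this
    exact ⟨g, hg, this⟩
  · refine fun x hx => hbasin hdδ (Or.inl ?_) x hx.1 (Or.inr (hnotEw x hx.1.1 hx.2))
    rw [← hlT]; gcongr
  · refine fun x hx => hbasin (by omega) (Or.inl ?_) x hx (Or.inl hd0)
    rw [← hlT]; gcongr
  · refine hbasinα hdδ (Or.inl ?_)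
    rw [← hlT]; gcongr
  · have hlam' : lam = δ := by omega
    obtain ⟨r₁, hr₁, hr₁₀, hinv⟩ := exists_wedge_forward_invariant_of_eq hl0 hc₁ hk₂ hr₀ hpb
      hqb (by rw [← hTδ, hlT]) hd2
    obtain ⟨η, hη, hη'⟩ := Metric.eventually_nhds_iff.1 ((hDo.eventually_mem h0D).and
      (eventually_norm_le_half_and_ne_zero hδ hc₁ hpb))
    have hη'' : ∀ z : ℂ, ‖z‖ < min η r₁ → z ∈ D ∧ ‖p z‖ ≤ 1 / 2 * ‖z‖ ∧ (z ≠ 0 → p z ≠ 0) :=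
      fun z hz => hη' (by rw [dist_zero_right]; exact hz.trans_le (min_le_left _ _))
    refine ⟨min η r₁, lt_min hη hr₁, fun r hr hrr => ?_⟩
    have hwedge : ∀ x ∈ allPreimages (D ×ˢ univ) F (wedge l₁ r),
        (∀ k, F^[k] x ∈ D ×ˢ (univ : Set ℂ)) ∧ Tendsto (fun k => (F^[k] x).1) atTop (𝓝 0) ∧
        ∀ᶠ k in atTop, (F^[k] x).1 ≠ 0 ∧ ‖(F^[k] x).2‖ ≤ r₀ * ‖(F^[k] x).1‖ ^ l₁ := by
      rintro x ⟨N, hxD, hxN⟩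
      obtain ⟨hmem, hlim⟩ := forward_orbit_mem_wedge
        (z := fun k => (F^[k] x).1) (w := fun k => (F^[k] x).2) (r₁ := min η r₁) hr hrr hl0.ne'
        (fun z hz => (hη'' z hz).2)
        (fun z w hz0 hz => hinv r hr (hrr.trans_le (min_le_right _ _)) z w hz0
          (hz.trans_le (min_le_right _ _))) (hfst x) (hsnd x) hxN
      refine ⟨fun k => ?_, hlim, eventually_atTop.2 ⟨N, fun k hk => ⟨(hmem k hk).1,
        (hmem k hk).2.2.le.trans ?_⟩⟩⟩
      · rcases le_total k N with hk | hk
        · exact hxD k hk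
        · exact ⟨(hη'' _ ((hmem k hk).2.1.trans hrr)).1, mem_univ _⟩
      · have : r ≤ r₀ := (hrr.le.trans (min_le_right _ _)).trans hr₁₀
        gcongr
    have hkey : ∀ x ∈ allPreimages (D ×ˢ univ) F (wedge l₁ r), (∀ k, (F^[k] x).2 ≠ 0) →
        ∃ g : EReal, IsGp p δ x.1 g ∧ IsGz F lam x ((α : EReal) * g) := by
      intro x hx hne
      obtain ⟨-, hlim, hev⟩ := hwedge x hx
      obtain ⟨g, hg, hg'⟩ := hasLogRate_of_eventually_mem_wedge hδ hdδ (hαδ hdδ) hc₁ hc₂ hpb hr₀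
        hk₁ hk₂ hqb (hfst x) (hsnd x) hlim (hev.mono fun k hk => hk.1)
        (hev.mono fun k hk => hk.2) (Or.inr hne)
      rw [← hlam'] at hg'
      exact ⟨g, isGp_iff.2 hg, hg'⟩
    refine ⟨fun x hx => hkey x hx.1 (hnotEw x (hwedge x hx.1).1 hx.2), fun x hx => ?_⟩
    by_cases hne : ∀ k, (F^[k] x).2 ≠ 0
    · obtain ⟨g, hg, hg'⟩ := hkey x hx hne
      exact ⟨g, hg, hGfα hdδ x g _ hg hg' le_rfl⟩
    · push Not at hne
      obtain ⟨N, hN⟩ := hne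
      obtain ⟨hxΩ, hlim, -⟩ := hwedge x hx
      obtain ⟨⟨g, hg⟩, -⟩ := exists_hasLogRate_of_tendsto_zero hδ hc₁ hc₂ hpb (hfst x) hlim
      have hg' : IsGp p δ x.1 g := isGp_iff.2 hg
      exact ⟨g, hg', hGfα hdδ x g _ hg' (hEwbot (by omega) x hxΩ N hN) bot_le⟩
  · exact fun x hx => hbasin hdδ (Or.inr ⟨hTδ, hd2, hpos⟩) x hx.1
      (Or.inr (hnotEw x hx.1.1 hx.2))
  · exact hbasinα hdδ (Or.inr ⟨hTδ, hd2, hpos⟩)
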